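/- \textbf{Theorem (Linear local contraction rate).} Let $f:\mathbb R^{n_v}\to\mathbb R$, $g:\mathbb R^{n_v}\to\mathbb R^{n_g}$, $h:\mathbb R^{n_v}\to\mathbb R^{n_h}$ be twice continuously differentiable (the data of the problem $\min f(v)$ s.t. $g(v)=0$, $h(v)\le 0$). For primal-dual vectors $z=(v,\lambda,\mu)\in\mathbb R^{n_v}\times\mathbb R^{n_g}\times\mathbb R^{n_h}$ let $W(z)$ be a symmetric positive semidefinite matrix (Hessian approximation), $q(z)\in\mathbb R^{n_v}$ (gradient approximation), and let $G(v)\in\mathbb R^{n_v\times n_g}$, $H(v)\in\mathbb R^{n_v\times n_h}$ approximate $\nabla g(v)$, $\nabla h(v)$ (transposed Jacobians). For $\bar z=(\bar v,\bar\lambda,\bar\mu)$ consider the quadratic program $$\mathrm{QP}(\bar z):\quad \min_v\ \tfrac12 (v-\bar v)^\top W(\bar z)(v-\bar v)+q(\bar z)^\top(v-\bar v)\quad\text{s.t.}\quad g(\bar v)+G(\bar v)^\top(v-\bar v)=0,\quad h(\bar v)+H(\bar v)^\top(v-\bar v)\le 0,$$ and let $\pi$ be a primal-dual solution operator: $\pi(\bar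 z)$ satisfies the KKT conditions of $\mathrm{QP}(\bar z)$ whenever these are solvable. The (inexact) SQP-type iteration is $z_{k+1}=\pi(z_k)$. Let $z^\star=(v^\star,\lambda^\star,\mu^\star)$ be a fixed point of the iteration, i.e. a KKT point of $\mathrm{QP}(z^\star)$, at which SOSC, LICQ and strict complementarity hold for $\mathrm{QP}(z^\star)$. Assume that $W$ is continuous and $q$ differentiable at $z^\star$, and that $G,H$ are differentiable at $v^\star$. Let $\mathcal A=\{i: h_i(v^\star)=0\}$, $\tilde g=(g,h_{\mathcal A})$, $\tilde G=(G,H_{\mathcal A})$, $\tilde\lambda=(\lambda,\mu_{\mathcal A})$, and define, in the reduced variables $(v,\tilde\lambda)$ (multipliers of inactive constraints being $0$), $$R(z;\bar z)=\begin{bmatrix}W(\bar z)(v-\bar v)+q(\bar z)+\tilde G(\bar v)\tilde\lambda\\ \tilde g(\bar v)+\tilde G(\bar v)^\top(v-\bar v)\end{bmatrix}.$$ Then for all $z$ in a neighbourhood of $z^\star$ the KKT conditions of $\mathrm{QP}(z)$ have the unique solution $\pi(z)$, and $\pi(z^\star)=z^\star$; moreover $$K_\star:=\frac{\partial R}{\partial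 z}(z^\star;z^\star)=\begin{bmatrix}W(z^\star)&\tilde G(v^\star)\\ \tilde G(v^\star)^\top&0\end{bmatrix}\ \text{is invertible},\qquad L_\star:=\frac{\partial R}{\partial\bar z}(z^\star;z^\star)=\begin{bmatrix}E_\star&D_\star\\ C_\star&0\end{bmatrix},$$ with $E_\star=\frac{\partial}{\partial v}q(z^\star)+\frac{\partial}{\partial v}\big(\tilde G(v)\tilde\lambda^\star\big)\big|_{v^\star}-W(z^\star)$, $C_\star=\nabla\tilde g(v^\star)^\top-\tilde G(v^\star)^\top$, $D_\star=\frac{\partial}{\partial\tilde\lambda}q(z^\star)$. Let $A_\star=K_\star^{-1}L_\star$ and let $\kappa=\rho(A_\star)$ be its spectral radius (largest modulus of a complex eigenvalue; $0$ if the matrix is empty). \begin{enumerate} \item If $0<\kappa<1$, the iterates converge locally to $z^\star$, Q-linearly with asymptotic rate $\kappa$, in the following sense: all iterates started close to $z^\star$ converge to $z^\star$; for every $r\in(\kappa,1)$ there are a norm $N$ and a neighbourhood of $z^\star$ such that $N(z_{k+1}-z^\star)\le r\,N(z_k-z^\star)$ for all $k$ and all $z_0$ in the neighbourhood; and for every $0<r<\kappa$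 there are starting points $z_0$ arbitrarily close to $z^\star$ with $\|z_k-z^\star\|\ne O(r^k)$. \item If $\kappa=0$, the iterates converge locally superlinearly to $z^\star$, in the following sense: all iterates started in some neighbourhood of $z^\star$ converge to $z^\star$ with $\|z_k-z^\star\|=o(r^k)$ for every $r>0$; and for every $r\in(0,1)$ there are a norm $N$ and a neighbourhood of $z^\star$ such that $N(z_{k+1}-z^\star)\le r\,N(z_k-z^\star)$ for all $k$ and all $z_0$ in the neighbourhood. \item If $\kappa=1$, the spectral radius alone does not decide about convergence: there are problems and methods with such a fixed point $z^\star$ and $\kappa=1$ for which all iterates started close to $z^\star$ converge to $z^\star$, and others with $\kappa=1$ for which this fails. \item If $\kappa>1$, then $z^\star$ is unstable, i.e. not Lyapunov stable for $z_{k+1}=\pi(z_k)$. \end{enumerate} -/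

import Mathlib

open Filter Topology Asymptotics Matrix

noncomputable section

/-- A primal-dual vector `z = (v, λ, μ)`. Every metric notion used below (limits, derivatives,
stability, orders of magnitude) is independent of the norm chosen on this space. -/
abbrev PrimalDual (nv ng nh : ℕ) : Type := (Fin nv → ℝ) × (Fin ng → ℝ) × (Fin nh → ℝ)

/-! ### Quadratic programs -/

/-- The quadratic program in the variable `v`
  `minimize ½ (v - c)ᵀ W (v - c) + qᵀ (v - c)`
  `subject to g + Gᵀ (v - c) = 0` and `h + Hᵀ (v - c) ≤ 0`. -/
structure QP (nv ng nh : ℕ) where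
  c : Fin nv → ℝ
  W : Matrix (Fin nv) (Fin nv) ℝ
  q : Fin nv → ℝ
  g : Fin ng → ℝ
  G : Matrix (Fin nv) (Fin ng) ℝ
  h : Fin nh → ℝ
  H : Matrix (Fin nv) (Fin nh) ℝ

namespace QP

variable {nv ng nh : ℕ}

/-- The values of the equality constraints at `v`. -/
def eqVal (Q : QP nv ng nh) (v : Fin nv → ℝ) : Fin ng → ℝ := Q.g + Q.Gᵀ *ᵥ (v - Q.c)

/-- The values of the inequality constraints at `v`. -/
def ineqVal (Q : QP nv ng nh) (v : Fin nv → ℝ) : Fin nh → ℝ := Q.h + Q.Hᵀ *ᵥ (v - Q.c)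

/-- The KKT conditions of the QP at the primal-dual point `z = (v, λ, μ)`. -/
structure IsKKT (Q : QP nv ng nh) (z : PrimalDual nv ng nh) : Prop where
  stationary : Q.W *ᵥ (z.1 - Q.c) + Q.q + Q.G *ᵥ z.2.1 + Q.H *ᵥ z.2.2 = 0
  primal_eq : Q.eqVal z.1 = 0
  primal_ineq : ∀ i, Q.ineqVal z.1 i ≤ 0
  dual : ∀ i, 0 ≤ z.2.2 i
  complementary : ∀ i, z.2.2 i * Q.ineqVal z.1 i = 0

/-- The inequality constraints that are active at `v`. -/
def active (Q : QP nv ng nh) (v : Fin nv → ℝ) : Finset (Fin nh) :=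
  Finset.univ.filter fun i => Q.ineqVal v i = 0

/-- Linear independence constraint qualification: the gradients of the equality constraints and
of the active inequality constraints are linearly independent. -/
def LICQ (Q : QP nv ng nh) (v : Fin nv → ℝ) : Prop :=
  LinearIndependent ℝ
    (Sum.elim (fun j : Fin ng => Q.G.col j) (fun i : Q.active v => Q.H.col i.1))

/-- Strict complementarity: active inequality constraints have positive multipliers. -/
def StrictComplementarity (Q : QP nv ng nh) (z : PrimalDual nv ng nh) : Prop :=
  ∀ i ∈ Q.active z.1, 0 < z.2.2 i

/-- The critical cone of the QP at `z = (v, λ, μ)`. -/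
def criticalCone (Q : QP nv ng nh) (z : PrimalDual nv ng nh) : Set (Fin nv → ℝ) :=
  {d | (∀ j, Q.G.col j ⬝ᵥ d = 0) ∧
    (∀ i ∈ Q.active z.1, 0 < z.2.2 i → Q.H.col i ⬝ᵥ d = 0) ∧
    (∀ i ∈ Q.active z.1, z.2.2 i = 0 → Q.H.col i ⬝ᵥ d ≤ 0)}

/-- Second-order sufficient conditions at `z`: the KKT conditions hold and the Hessian of the
Lagrangian of the QP, which is `W`, is positive on the nonzero vectors of the critical cone. -/
def SOSC (Q : QP nv ng nh) (z : PrimalDual nv ng nh) : Prop :=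
  Q.IsKKT z ∧ ∀ d ∈ Q.criticalCone z, d ≠ 0 → 0 < d ⬝ᵥ (Q.W *ᵥ d)

end QP

/-! ### SQP-type methods -/

/-- The data of an SQP-type method: the functions of the nonlinear program
`min f(v)` subject to `g(v) = 0`, `h(v) ≤ 0`, and the approximations `W` of the Hessian of its
Lagrangian, `q` of the gradient of `f` and `G`, `H` of the gradients (transposed Jacobians) of
`g`, `h`. -/
structure SQPMethod (nv ng nh : ℕ) where
  f : (Fin nv → ℝ) → ℝ
  g : (Fin nv → ℝ) → (Fin ng → ℝ)
  h : (Fin nv → ℝ) → (Fin nh → ℝ)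
  W : PrimalDual nv ng nh → Matrix (Fin nv) (Fin nv) ℝ
  q : PrimalDual nv ng nh → (Fin nv → ℝ)
  G : (Fin nv → ℝ) → Matrix (Fin nv) (Fin ng) ℝ
  H : (Fin nv → ℝ) → Matrix (Fin nv) (Fin nh) ℝ

/-- The Jacobian matrix of `F` at `x`. -/
def jacobianMatrix {ι κ : Type} [Fintype ι] [DecidableEq ι] [Fintype κ]
    (F : (ι → ℝ) → (κ → ℝ)) (x : ι → ℝ) : Matrix κ ι ℝ :=
  LinearMap.toMatrix' (fderiv ℝ F x).toLinearMap

namespace SQPMethod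

variable {nv ng nh : ℕ}

/-- Standing assumptions: the functions of the nonlinear program are twice continuously
differentiable, `W` is positive semidefinite (and symmetric), and the approximations are regular
enough at `zs` for the partial Jacobians of the reduced KKT residual to exist there. -/
structure IsRegularAt (P : SQPMethod nv ng nh) (zs : PrimalDual nv ng nh) : Prop where
  contDiff_f : ContDiff ℝ 2 P.f
  contDiff_g : ContDiff ℝ 2 P.g
  contDiff_h : ContDiff ℝ 2 P.h
  posSemidef_W : ∀ z, (P.W z).PosSemidef
  continuousAt_W : ∀ i j, ContinuousAt (fun z => P.W z i j) zs
  differentiableAt_q : DifferentiableAt ℝ P.q zs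
  differentiableAt_G : ∀ i j, DifferentiableAt ℝ (fun v => P.G v i j) zs.1
  differentiableAt_H : ∀ i j, DifferentiableAt ℝ (fun v => P.H v i j) zs.1

/-- The QP subproblem at the iterate `z`. -/
def localQP (P : SQPMethod nv ng nh) (z : PrimalDual nv ng nh) : QP nv ng nh where
  c := z.1
  W := P.W z
  q := P.q z
  g := P.g z.1
  G := P.G z.1
  h := P.h z.1
  H := P.H z.1

/-- `π` is a primal-dual solution operator of the QP subproblems: `π z` satisfies the KKT
conditions of the QP at `z` whenever these are solvable. -/
def IsSolutionOperator (P : SQPMethod nv ng nh)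
    (π : PrimalDual nv ng nh → PrimalDual nv ng nh) : Prop :=
  ∀ z, (∃ w, (P.localQP z).IsKKT w) → (P.localQP z).IsKKT (π z)

/-- `zs` is a fixed point of the iteration: it solves the KKT conditions of its own QP. -/
def IsFixedPoint (P : SQPMethod nv ng nh) (zs : PrimalDual nv ng nh) : Prop :=
  (P.localQP zs).IsKKT zs

/-- `zs` is a fixed point of the iteration at which SOSC, LICQ and strict complementarity hold
for the QP at `zs`. -/
structure RegularFixedPoint (P : SQPMethod nv ng nh) (zs : PrimalDual nv ng nh) : Prop where
  fixed : P.IsFixedPoint zs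
  sosc : (P.localQP zs).SOSC zs
  licq : (P.localQP zs).LICQ zs.1
  strict : (P.localQP zs).StrictComplementarity zs

/-! #### The reduced KKT residual -/

/-- The active set of the QP at `zs`, evaluated at `zs`. -/
abbrev act (P : SQPMethod nv ng nh) (zs : PrimalDual nv ng nh) : Finset (Fin nh) :=
  (P.localQP zs).active zs.1

/-- Index type of the reduced multipliers `λ̃ = (λ, μ_𝒜)`. -/
abbrev MulIdx (P : SQPMethod nv ng nh) (zs : PrimalDual nv ng nh) : Type :=
  Fin ng ⊕ P.act zs

/-- Index type of the reduced primal-dual vectors `(v, λ̃)`. -/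
abbrev RedIdx (P : SQPMethod nv ng nh) (zs : PrimalDual nv ng nh) : Type :=
  Fin nv ⊕ P.MulIdx zs

/-- The full primal-dual vector of `(v, λ̃)`; multipliers of inactive constraints are `0`. -/
def extend (P : SQPMethod nv ng nh) (zs : PrimalDual nv ng nh) (x : P.RedIdx zs → ℝ) :
    PrimalDual nv ng nh :=
  (fun i => x (Sum.inl i), fun j => x (Sum.inr (Sum.inl j)),
    fun i => if hi : i ∈ P.act zs then x (Sum.inr (Sum.inr ⟨i, hi⟩)) else 0)

/-- The reduced multipliers `λ̃⋆ = (λ⋆, μ⋆_𝒜)` of `zs`. -/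
def redMul (P : SQPMethod nv ng nh) (zs : PrimalDual nv ng nh) : P.MulIdx zs → ℝ :=
  Sum.elim zs.2.1 (fun i => zs.2.2 i.1)

/-- The reduced primal-dual vector of `zs`. -/
def redPoint (P : SQPMethod nv ng nh) (zs : PrimalDual nv ng nh) : P.RedIdx zs → ℝ :=
  Sum.elim zs.1 (P.redMul zs)

/-- `g̃ = (g, h_𝒜)`. -/
def gRed (P : SQPMethod nv ng nh) (zs : PrimalDual nv ng nh) (v : Fin nv → ℝ) :
    P.MulIdx zs → ℝ :=
  Sum.elim (P.g v) (fun i => P.h v i.1)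

/-- `G̃ = (G, H_𝒜)`. -/
def GRed (P : SQPMethod nv ng nh) (zs : PrimalDual nv ng nh) (v : Fin nv → ℝ) :
    Matrix (Fin nv) (P.MulIdx zs) ℝ :=
  Matrix.fromCols (P.G v) (Matrix.of fun i (j : P.act zs) => P.H v i j.1)

/-- The reduced KKT residual `R(z; z̄)`, for `z = (v, λ̃)` and `z̄` in reduced variables. -/
def residual (P : SQPMethod nv ng nh) (zs : PrimalDual nv ng nh) (x y : P.RedIdx zs → ℝ) :
    P.RedIdx zs → ℝ :=
  let v : Fin nv → ℝ := fun i => x (Sum.inl i)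
  let mul : P.MulIdx zs → ℝ := fun j => x (Sum.inr j)
  let w : Fin nv → ℝ := fun i => y (Sum.inl i)
  Sum.elim
    (P.W (P.extend zs y) *ᵥ (v - w) + P.q (P.extend zs y) + P.GRed zs w *ᵥ mul)
    (P.gRed zs w + (P.GRed zs w)ᵀ *ᵥ (v - w))

/-- `K⋆ = [W⋆, G̃⋆; G̃⋆ᵀ, 0]`. -/
def K (P : SQPMethod nv ng nh) (zs : PrimalDual nv ng nh) :
    Matrix (P.RedIdx zs) (P.RedIdx zs) ℝ :=
  Matrix.fromBlocks (P.W zs) (P.GRed zs zs.1) (P.GRed zs zs.1)ᵀ 0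

/-- `E⋆ = ∂q/∂v (z⋆) + ∂(G̃(v) λ̃⋆)/∂v (v⋆) - W⋆`. -/
def E (P : SQPMethod nv ng nh) (zs : PrimalDual nv ng nh) : Matrix (Fin nv) (Fin nv) ℝ :=
  jacobianMatrix (fun v => P.q (v, zs.2)) zs.1
    + jacobianMatrix (fun v => P.GRed zs v *ᵥ P.redMul zs) zs.1 - P.W zs

/-- `C⋆ = ∇g̃(v⋆)ᵀ - G̃(v⋆)ᵀ`. -/
def C (P : SQPMethod nv ng nh) (zs : PrimalDual nv ng nh) : Matrix (P.MulIdx zs) (Fin nv) ℝ :=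
  jacobianMatrix (P.gRed zs) zs.1 - (P.GRed zs zs.1)ᵀ

/-- `D⋆ = ∂q/∂λ̃ (z⋆)`. -/
def D (P : SQPMethod nv ng nh) (zs : PrimalDual nv ng nh) : Matrix (Fin nv) (P.MulIdx zs) ℝ :=
  jacobianMatrix (fun mul => P.q (P.extend zs (Sum.elim zs.1 mul))) (P.redMul zs)

/-- `L⋆ = [E⋆, D⋆; C⋆, 0]`. -/
def L (P : SQPMethod nv ng nh) (zs : PrimalDual nv ng nh) :
    Matrix (P.RedIdx zs) (P.RedIdx zs) ℝ :=
  Matrix.fromBlocks (P.E zs) (P.D zs) (P.C zs) 0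

/-- The iteration matrix `A⋆ = K⋆⁻¹ L⋆`. -/
def iterationMatrix (P : SQPMethod nv ng nh) (zs : PrimalDual nv ng nh) :
    Matrix (P.RedIdx zs) (P.RedIdx zs) ℝ :=
  (P.K zs)⁻¹ * P.L zs

/-- `κ = ρ(A⋆)`, the largest modulus of a complex eigenvalue of `A⋆` (`0` if there is none). -/
def kappa (P : SQPMethod nv ng nh) (zs : PrimalDual nv ng nh) : ℝ :=
  (spectralRadius ℂ ((P.iterationMatrix zs).map (algebraMap ℝ ℂ))).toReal

end SQPMethod

/-! ### Local convergence of fixed-point iterations -/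

section Convergence

variable {X : Type} [NormedAddCommGroup X] [NormedSpace ℝ X]

/-- The iterates of `π` started close to `zs` converge to `zs`. -/
def LocallyConvergent (π : X → X) (zs : X) : Prop :=
  ∃ U ∈ 𝓝 zs, ∀ z₀ ∈ U, Tendsto (fun k => π^[k] z₀) atTop (𝓝 zs)

/-- In a suitable norm, the distance to `zs` shrinks at least by the factor `r` in every step of
the iteration, for all starting points close to `zs`. -/
def QLinearWithFactor (π : X → X) (zs : X) (r : ℝ) : Prop :=
  ∃ N : Seminorm ℝ X, (∀ x, N x = 0 → x = 0) ∧
    ∃ U ∈ 𝓝 zs, ∀ z₀ ∈ U, ∀ k : ℕ, N (π^[k + 1] z₀ - zs) ≤ r * N (π^[k] z₀ - zs)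

/-- Q-linear local convergence with asymptotic rate `κ`: every factor `r > κ` is a Q-linear
contraction factor (in a norm that may depend on `r`), and no `r < κ` is a rate of
convergence: arbitrarily close to `zs` there are starting points whose errors are not `O(r ^ k)`. -/
def ConvergesQLinearly (π : X → X) (zs : X) (κ : ℝ) : Prop :=
  LocallyConvergent π zs ∧
  (∀ r, κ < r → r < 1 → QLinearWithFactor π zs r) ∧
  (∀ r, 0 < r → r < κ → ∀ U ∈ 𝓝 zs, ∃ z₀ ∈ U,
    ¬ (fun k : ℕ => π^[k] z₀ - zs) =O[atTop] (fun k : ℕ => r ^ k))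

/-- Superlinear local convergence: the errors of all iterations started close to `zs` vanish
faster than every geometric sequence, and every `r > 0` is a Q-linear contraction factor (in a
norm that may depend on `r`). -/
def ConvergesSuperlinearly (π : X → X) (zs : X) : Prop :=
  LocallyConvergent π zs ∧
  (∃ U ∈ 𝓝 zs, ∀ z₀ ∈ U, ∀ r : ℝ, 0 < r →
    (fun k : ℕ => π^[k] z₀ - zs) =o[atTop] (fun k : ℕ => r ^ k)) ∧
  (∀ r, 0 < r → r < 1 → QLinearWithFactor π zs r)

/-- Lyapunov stability of `zs` under the iteration of `π`. -/
def IsStable (π : X → X) (zs : X) : Prop :=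
  ∀ ε > 0, ∃ δ > 0, ∀ z₀, dist z₀ zs < δ → ∀ k : ℕ, dist (π^[k] z₀) zs < ε

end Convergence

end

/-! Near `zs` the nonlinear iteration is governed by one linear system. Strict complementarity and
continuity freeze the active set, so the KKT conditions of the QP at `z` reduce to R(x; z) = 0. This
is affine in x with a matrix close to `K`, and `K` is invertible by SOSC and LICQ. Uniqueness among
all KKT points, not only nearby ones, comes from convexity: two KKT points of a convex QP are
complementary to each other (`QP.IsKKT.cross_complementary`), so any competitor solves the same
linear system. This gives `eventually_isKKT_iff`.

Differentiating R(π(z); z) = 0 suggests the derivative -K⁻¹L = -A in reduced variables. Although `W`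
is only continuous, it multiplies v - v̄, which vanishes at `zs`; the inverse KKT matrix is only
continuous too, but multiplies a residual that vanishes there. A continuous factor times a
differentiable factor that vanishes is differentiable, so `π` is differentiable at `zs`. Since `W`
and `q` may also depend on inactive multipliers, `π` acts on the full space; `FactorsThrough`
records that it has the form zs + i(F z) with F' ∘ i = -A.

Upper bounds on the error use a norm adapted to A, built from Gelfand's formula. Lower bounds use a
splitting into spectral subspaces on which A expands by a, respectively grows by at most b < a: the
cone where the expanding seminorm dominates is mapped into itself, and inside it errors grow almost
like a ^ k (`FactorsThrough.exists_expansion`). No invariant manifold is needed, so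
differentiability at the single point `zs` suffices. Taking r < κ < 1 excludes faster rates; taking
r = 1 < κ excludes stability.

For κ = 1 the examples are gradient descent in one variable with f''(0) = 0: x ↦ x - x³ converges,
the identity does not. -/

noncomputable section

/-! ### Monotonicity of the KKT system of a convex QP -/

namespace QP

variable {nv ng nh : ℕ}

/-- Monotonicity of the KKT system of a convex QP: the multipliers of each of two KKT points
are complementary to the constraint values at the other. -/
theorem IsKKT.cross_complementary {Q : QP nv ng nh} (hW : Q.W.PosSemidef)
    {z w : PrimalDual nv ng nh} (hz : Q.IsKKT z) (hw : Q.IsKKT w) (i : Fin nh) :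
    z.2.2 i * Q.ineqVal w.1 i = 0 ∧ w.2.2 i * Q.ineqVal z.1 i = 0 := by
  have hd : Q.W *ᵥ (z.1 - w.1) + Q.G *ᵥ (z.2.1 - w.2.1) + Q.H *ᵥ (z.2.2 - w.2.2) = 0 := by
    have h1 := hz.stationary
    have h2 := hw.stationary
    have h3 : z.1 - w.1 = (z.1 - Q.c) - (w.1 - Q.c) := by abel
    rw [h3, mulVec_sub Q.W, mulVec_sub Q.G, mulVec_sub Q.H]
    rw [← sub_eq_zero.mpr (h1.trans h2.symm)]
    abel
  have hG : Q.Gᵀ *ᵥ (z.1 - w.1) = 0 := by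
    have h3 : z.1 - w.1 = (z.1 - Q.c) - (w.1 - Q.c) := by abel
    have := sub_eq_zero.mpr (hz.primal_eq.trans hw.primal_eq.symm)
    rw [h3, mulVec_sub, ← this]
    simp only [eqVal]
    abel
  have hH : Q.Hᵀ *ᵥ (z.1 - w.1) = Q.ineqVal z.1 - Q.ineqVal w.1 := by
    have h3 : z.1 - w.1 = (z.1 - Q.c) - (w.1 - Q.c) := by abel
    rw [h3, mulVec_sub]
    simp only [ineqVal]
    abel
  have hpos : 0 ≤ (z.1 - w.1) ⬝ᵥ (Q.W *ᵥ (z.1 - w.1)) := by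
    simpa using hW.dotProduct_mulVec_nonneg (z.1 - w.1)
  have hsum : (z.1 - w.1) ⬝ᵥ (Q.W *ᵥ (z.1 - w.1))
      + (Q.ineqVal z.1 - Q.ineqVal w.1) ⬝ᵥ (z.2.2 - w.2.2) = 0 := by
    have := congrArg (fun u => (z.1 - w.1) ⬝ᵥ u) hd
    simp only [dotProduct_add, dotProduct_zero] at this
    rw [dotProduct_mulVec _ Q.G, dotProduct_mulVec _ Q.H, ← mulVec_transpose,
      ← mulVec_transpose, hG, hH] at this
    simpa using this
  -- The products belonging to a single KKT point vanish by its own complementarity. What remains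
  -- are the two cross products, each of a fixed sign, so a vanishing total forces every one of them
  -- to vanish.
  have hterm : ∀ j, (Q.ineqVal z.1 - Q.ineqVal w.1) j * (z.2.2 - w.2.2) j
      = - (z.2.2 j * Q.ineqVal w.1 j) - w.2.2 j * Q.ineqVal z.1 j := by
    intro j
    have h1 := hz.complementary j
    have h2 := hw.complementary j
    simp only [Pi.sub_apply]
    linear_combination h1 + h2
  have hnn1 : ∀ j, 0 ≤ - (z.2.2 j * Q.ineqVal w.1 j) := fun j => by
    have := mul_nonneg (hz.dual j) (neg_nonneg.mpr (hw.primal_ineq j)); linarith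
  have hnn2 : ∀ j, 0 ≤ - (w.2.2 j * Q.ineqVal z.1 j) := fun j => by
    have := mul_nonneg (hw.dual j) (neg_nonneg.mpr (hz.primal_ineq j)); linarith
  have hnn : ∀ j, 0 ≤ (Q.ineqVal z.1 - Q.ineqVal w.1) j * (z.2.2 - w.2.2) j := fun j => by
    rw [hterm]; linarith [hnn1 j, hnn2 j]
  have h0 : (Q.ineqVal z.1 - Q.ineqVal w.1) ⬝ᵥ (z.2.2 - w.2.2) = 0 :=
    le_antisymm (by linarith) (Finset.sum_nonneg fun j _ => hnn j)
  have hi := (Finset.sum_eq_zero_iff_of_nonneg fun j _ => hnn j).mp h0 i (Finset.mem_univ i)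
  rw [hterm] at hi
  constructor <;> linarith [hnn1 i, hnn2 i]

end QP

/-! ### Reduction of the KKT conditions to a linear system -/

namespace SQPMethod

variable {nv ng nh : ℕ} (P : SQPMethod nv ng nh) (zs : PrimalDual nv ng nh)

/-- `extend` as a linear map. -/
def extendLM : (P.RedIdx zs → ℝ) →ₗ[ℝ] PrimalDual nv ng nh where
  toFun := P.extend zs
  map_add' x y := by
    refine Prod.ext rfl (Prod.ext rfl (funext fun i => ?_))
    by_cases hi : i ∈ P.act zs <;> simp [extend, hi]
  map_smul' c x := by
    refine Prod.ext rfl (Prod.ext rfl (funext fun i => ?_))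
    by_cases hi : i ∈ P.act zs <;> simp [extend, hi]

/-- `extend` as a continuous linear map. -/
def extendCLM : (P.RedIdx zs → ℝ) →L[ℝ] PrimalDual nv ng nh :=
  LinearMap.toContinuousLinearMap (P.extendLM zs)

@[simp] theorem extendCLM_apply (x : P.RedIdx zs → ℝ) : P.extendCLM zs x = P.extend zs x := rfl

/-- The reduced variables `(v, λ̃)` of a full primal-dual vector. -/
def restrict (w : PrimalDual nv ng nh) : P.RedIdx zs → ℝ :=
  Sum.elim w.1 (Sum.elim w.2.1 fun i => w.2.2 i.1)

theorem restrict_self : P.restrict zs zs = P.redPoint zs := rfl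

theorem extend_restrict {w : PrimalDual nv ng nh} (hw : ∀ i, i ∉ P.act zs → w.2.2 i = 0) :
    P.extend zs (P.restrict zs w) = w := by
  refine Prod.ext rfl (Prod.ext rfl (funext fun i => ?_))
  by_cases hi : i ∈ P.act zs
  · simp [restrict, extend, hi]
  · simp [extend, hi, hw i hi]

/-- The KKT matrix of the reduced linear system of the QP at `z`. -/
def kktMatrix (z : PrimalDual nv ng nh) : Matrix (P.RedIdx zs) (P.RedIdx zs) ℝ :=
  Matrix.fromBlocks (P.W z) (P.GRed zs z.1) (P.GRed zs z.1)ᵀ 0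

/-- The reduced KKT residual of the QP at a full primal-dual vector `z`. -/
def qpResidual (x : P.RedIdx zs → ℝ) (z : PrimalDual nv ng nh) : P.RedIdx zs → ℝ :=
  Sum.elim
    (P.W z *ᵥ ((fun i => x (Sum.inl i)) - z.1) + P.q z + P.GRed zs z.1 *ᵥ fun j => x (Sum.inr j))
    (P.gRed zs z.1 + (P.GRed zs z.1)ᵀ *ᵥ ((fun i => x (Sum.inl i)) - z.1))

theorem residual_eq_qpResidual (x y : P.RedIdx zs → ℝ) :
    P.residual zs x y = P.qpResidual zs x (P.extend zs y) := rfl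

theorem qpResidual_eq_add (x y : P.RedIdx zs → ℝ) (z : PrimalDual nv ng nh) :
    P.qpResidual zs x z = P.qpResidual zs y z + P.kktMatrix zs z *ᵥ (x - y) := by
  have h1 : (fun i => x (Sum.inl i)) - z.1
      = ((fun i => y (Sum.inl i)) - z.1) + (x - y) ∘ Sum.inl := by
    funext i; simp
  have h2 : (fun j => x (Sum.inr j)) = (fun j => y (Sum.inr j)) + (x - y) ∘ Sum.inr := by
    funext i; simp
  rw [kktMatrix, fromBlocks_mulVec, qpResidual, qpResidual, h1, h2]
  simp only [mulVec_add, zero_mulVec, add_zero]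
  funext i
  rcases i with i | i
  · simp only [Sum.elim_inl, Pi.add_apply]; ring
  · simp only [Sum.elim_inr, Pi.add_apply]; ring

theorem GRed_mulVec (v : Fin nv → ℝ) (x : P.RedIdx zs → ℝ) :
    (P.GRed zs v *ᵥ fun j => x (Sum.inr j))
      = P.G v *ᵥ (P.extend zs x).2.1 + P.H v *ᵥ (P.extend zs x).2.2 := by
  have h : (fun j => x (Sum.inr j)) = Sum.elim (P.extend zs x).2.1
      (fun i : P.act zs => (P.extend zs x).2.2 i.1) := by
    funext j
    rcases j with j | ⟨j, hj⟩
    · rfl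
    · simp [extend]
  rw [h, GRed, fromCols_mulVec_sumElim]
  congr 1
  funext i
  simp only [mulVec, dotProduct, of_apply]
  rw [Finset.sum_coe_sort (P.act zs) (fun j => P.H v i j * (P.extend zs x).2.2 j)]
  refine Finset.sum_subset (Finset.subset_univ _) fun j _ hj => ?_
  simp [extend, hj]

/-- The equations among the KKT conditions, for points whose inactive multipliers vanish. -/
theorem qpResidual_eq_zero_iff (x : P.RedIdx zs → ℝ) (z : PrimalDual nv ng nh) :
    P.qpResidual zs x z = 0 ↔
      ((P.localQP z).W *ᵥ ((P.extend zs x).1 - (P.localQP z).c) + (P.localQP z).q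
        + (P.localQP z).G *ᵥ (P.extend zs x).2.1 + (P.localQP z).H *ᵥ (P.extend zs x).2.2 = 0) ∧
      (P.localQP z).eqVal (P.extend zs x).1 = 0 ∧
      ∀ i ∈ P.act zs, (P.localQP z).ineqVal (P.extend zs x).1 i = 0 := by
  have h1 : P.qpResidual zs x z = Sum.elim
      ((P.localQP z).W *ᵥ ((P.extend zs x).1 - (P.localQP z).c) + (P.localQP z).q
        + (P.localQP z).G *ᵥ (P.extend zs x).2.1 + (P.localQP z).H *ᵥ (P.extend zs x).2.2)
      (Sum.elim ((P.localQP z).eqVal (P.extend zs x).1)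
        fun i => (P.localQP z).ineqVal (P.extend zs x).1 i.1) := by
    rw [qpResidual, GRed_mulVec, ← add_assoc]
    funext i
    rcases i with i | i | i <;> rfl
  rw [h1]
  constructor
  · intro h
    refine ⟨funext fun i => congrFun h (Sum.inl i), funext fun i => congrFun h (Sum.inr (Sum.inl i)),
      fun i hi => congrFun h (Sum.inr (Sum.inr ⟨i, hi⟩))⟩
  · rintro ⟨h2, h3, h4⟩
    funext i
    rcases i with i | i | i
    · exact congrFun h2 i
    · exact congrFun h3 i
    · exact h4 i.1 i.2

variable {P zs}

theorem isKKT_extend {x : P.RedIdx zs → ℝ} {z : PrimalDual nv ng nh}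
    (hx : P.qpResidual zs x z = 0) (hpos : ∀ i ∈ P.act zs, 0 < (P.extend zs x).2.2 i)
    (hneg : ∀ i, i ∉ P.act zs → (P.localQP z).ineqVal (P.extend zs x).1 i < 0) :
    (P.localQP z).IsKKT (P.extend zs x) := by
  obtain ⟨h1, h2, h3⟩ := (P.qpResidual_eq_zero_iff zs x z).mp hx
  have h4 : ∀ i, i ∉ P.act zs → (P.extend zs x).2.2 i = 0 := fun i hi => by simp [extend, hi]
  refine ⟨h1, h2, fun i => ?_, fun i => ?_, fun i => ?_⟩ <;> by_cases hi : i ∈ P.act zs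
  · exact (h3 i hi).le
  · exact (hneg i hi).le
  · exact (hpos i hi).le
  · exact (h4 i hi).ge
  · rw [h3 i hi, mul_zero]
  · rw [h4 i hi, zero_mul]

/-- Uniqueness of the KKT point of a convex QP at which strict complementarity holds and whose
reduced KKT matrix is invertible. -/
theorem isKKT_iff_eq_extend {x : P.RedIdx zs → ℝ} {z w : PrimalDual nv ng nh}
    (hW : (P.W z).PosSemidef) (hK : IsUnit (P.kktMatrix zs z))
    (hx : P.qpResidual zs x z = 0) (hpos : ∀ i ∈ P.act zs, 0 < (P.extend zs x).2.2 i)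
    (hneg : ∀ i, i ∉ P.act zs → (P.localQP z).ineqVal (P.extend zs x).1 i < 0) :
    (P.localQP z).IsKKT w ↔ w = P.extend zs x := by
  have hkkt := isKKT_extend hx hpos hneg
  refine ⟨fun hw => ?_, fun h => h ▸ hkkt⟩
  -- Strictness at the known solution decides each cross product: the inactive multipliers of `w`
  -- vanish, and the active constraints hold with equality at `w`. Hence `w` solves the same
  -- invertible linear system.
  have hcross := QP.IsKKT.cross_complementary (Q := P.localQP z) hW hkkt hw
  have hw0 : P.extend zs (P.restrict zs w) = w := P.extend_restrict zs fun i hi =>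
    (mul_eq_zero.mp (hcross i).2).resolve_right (hneg i hi).ne
  have hres : P.qpResidual zs (P.restrict zs w) z = 0 := by
    rw [qpResidual_eq_zero_iff, hw0]
    exact ⟨hw.stationary, hw.primal_eq, fun i hi =>
      (mul_eq_zero.mp (hcross i).1).resolve_left (hpos i hi).ne'⟩
  rw [P.qpResidual_eq_add zs _ x, hx, zero_add] at hres
  have := mulVec_injective_iff_isUnit.mpr hK (hres.trans (mulVec_zero _).symm)
  rw [← hw0, sub_eq_zero.mp this]

/-- Let (d, m) be in the kernel. The second block row puts d in the critical cone, by strict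
complementarity; pairing the first row with d gives dᵀWd = 0, so d = 0 by SOSC. Then G̃m = 0, so m =
0 by LICQ. -/
theorem isUnit_K (h : P.RegularFixedPoint zs) : IsUnit (P.K zs) := by
  rw [← mulVec_injective_iff_isUnit]
  refine (injective_iff_map_eq_zero (P.K zs).mulVecLin).mpr fun x hx => ?_
  rw [mulVecLin_apply, K, fromBlocks_mulVec] at hx
  have h1 : P.W zs *ᵥ (x ∘ Sum.inl) + P.GRed zs zs.1 *ᵥ (x ∘ Sum.inr) = 0 :=
    funext fun i => congrFun hx (Sum.inl i)
  have h2 : (P.GRed zs zs.1)ᵀ *ᵥ (x ∘ Sum.inl) = 0 :=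
    funext fun i => by simpa using congrFun hx (Sum.inr i)
  have hcone : x ∘ Sum.inl ∈ (P.localQP zs).criticalCone zs := by
    refine ⟨fun j => congrFun h2 (Sum.inl j), fun i hi _ => congrFun h2 (Sum.inr ⟨i, hi⟩),
      fun i hi h0 => absurd h0 (h.strict i hi).ne'⟩
  have hd : x ∘ Sum.inl = 0 := by
    by_contra hne
    have hp := h.sosc.2 _ hcone hne
    have h3 : (x ∘ Sum.inl) ⬝ᵥ (P.W zs *ᵥ (x ∘ Sum.inl)) = 0 := by
      have := congrArg (fun u => (x ∘ Sum.inl) ⬝ᵥ u) h1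
      simp only [dotProduct_add, dotProduct_zero] at this
      rw [dotProduct_mulVec _ (P.GRed zs zs.1), ← mulVec_transpose, h2, zero_dotProduct,
        add_zero] at this
      exact this
    exact hp.ne' h3
  have hm : x ∘ Sum.inr = 0 := by
    rw [hd, mulVec_zero, zero_add] at h1
    have hli : LinearIndependent ℝ (P.GRed zs zs.1).col := by
      have hcol : (P.GRed zs zs.1).col = Sum.elim (fun j => (P.localQP zs).G.col j)
          (fun i : P.act zs => (P.localQP zs).H.col i.1) := by
        funext j
        rcases j with j | j <;> rfl
      rw [hcol]
      exact h.licq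
    exact mulVec_injective_iff.mpr hli (h1.trans (mulVec_zero _).symm)
  funext i
  rcases i with i | i
  · exact congrFun hd i
  · exact congrFun hm i

end SQPMethod

/-! ### Products with a factor that is merely continuous -/

section Calculus

variable {X : Type*} [NormedAddCommGroup X] [NormedSpace ℝ X]

/-- Product rule at a zero of the second factor; the first factor need only be continuous. -/
theorem HasFDerivAt.mul_of_continuousAt_of_eq_zero {a u : X → ℝ} {u' : X →L[ℝ] ℝ} {x : X}
    (hu : HasFDerivAt u u' x) (ha : ContinuousAt a x) (h0 : u x = 0) :
    HasFDerivAt (fun z => a z * u z) (a x • u') x := by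
  have h1 : HasFDerivAt (fun z => a x * u z) (a x • u') x := hu.const_mul (a x)
  -- This remainder is o(1) times O(z - x), the latter because `u` vanishes at `x`.
  have h2 : HasFDerivAt (fun z => (a z - a x) * u z) (0 : X →L[ℝ] ℝ) x := by
    refine .of_isLittleO ?_
    have h3 : (fun z => a z - a x) =o[𝓝 x] (fun _ => (1 : ℝ)) :=
      (isLittleO_one_iff ℝ).mpr (by simpa using ha.tendsto.sub_const (a x))
    have h4 : u =O[𝓝 x] (fun z => z - x) := by simpa [h0] using hu.isBigO_sub
    simpa [h0] using h3.mul_isBigO h4.norm_right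
  convert! h1.add h2 using 1
  · funext z; simp only [Pi.add_apply]; ring
  · simp

variable {m n : Type*} [Fintype n]

theorem HasFDerivAt.mulVec_of_continuousAt_of_eq_zero [Finite m] {A : X → Matrix m n ℝ} {u : X → n → ℝ}
    {u' : X →L[ℝ] (n → ℝ)} {x : X} (hu : HasFDerivAt u u' x)
    (hA : ∀ i j, ContinuousAt (fun z => A z i j) x) (h0 : u x = 0) :
    HasFDerivAt (fun z => A z *ᵥ u z)
      ((LinearMap.toContinuousLinearMap (A x).mulVecLin).comp u') x := by
  have := Fintype.ofFinite m
  rw [hasFDerivAt_pi']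
  intro i
  have h : HasFDerivAt (fun z => ∑ j, A z i j * u z j)
      (∑ j, A x i j • (ContinuousLinearMap.proj j).comp u') x :=
    HasFDerivAt.fun_sum fun j _ =>
      ((hasFDerivAt_pi'.mp hu) j).mul_of_continuousAt_of_eq_zero (hA i j) (congrFun h0 j)
  convert! h using 1
  ext d
  simp [mulVec, dotProduct]

/-- Cramer's rule: the inverse is the adjugate over the determinant, both polynomial in the entries.
-/
theorem ContinuousAt.matrix_inv_apply [DecidableEq n] {Z : Type*} [TopologicalSpace Z]
    {A : Z → Matrix n n ℝ} {x : Z} (hA : ContinuousAt A x) (hu : IsUnit (A x)) (i j : n) :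
    ContinuousAt (fun z => (A z)⁻¹ i j) x := by
  have hdet : ContinuousAt (fun z => (A z).det) x :=
    (continuous_id.matrix_det).continuousAt.comp hA
  have hadj : ContinuousAt (fun z => (A z).adjugate i j) x :=
    ((continuous_id.matrix_adjugate).matrix_elem i j).continuousAt.comp hA
  have h0 : (A x).det ≠ 0 := ((isUnit_iff_isUnit_det _).mp hu).ne_zero
  simp only [inv_def, Ring.inverse_eq_inv', Matrix.smul_apply, smul_eq_mul]
  exact (hdet.inv₀ h0).mul hadj

end Calculus

theorem jacobianMatrix_mulVec {ι κ : Type} [Fintype ι] [DecidableEq ι] [Fintype κ]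
    (F : (ι → ℝ) → (κ → ℝ)) (x d : ι → ℝ) : jacobianMatrix F x *ᵥ d = fderiv ℝ F x d :=
  LinearMap.toMatrix'_mulVec _ d

/-! ### Derivative of the residual and of the QP solution -/

namespace SQPMethod

variable {nv ng nh : ℕ} {P : SQPMethod nv ng nh} {zs : PrimalDual nv ng nh}

theorem IsFixedPoint.extend_redPoint (h : P.IsFixedPoint zs) :
    P.extend zs (P.redPoint zs) = zs := by
  rw [← restrict_self]
  refine P.extend_restrict zs fun i hi => (mul_eq_zero.mp (h.complementary i)).resolve_right ?_
  simpa [act, QP.active] using hi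

theorem IsFixedPoint.qpResidual_eq_zero (h : P.IsFixedPoint zs) :
    P.qpResidual zs (P.redPoint zs) zs = 0 := by
  rw [qpResidual_eq_zero_iff, h.extend_redPoint]
  exact ⟨h.stationary, h.primal_eq, fun i hi => by simpa [act, QP.active] using hi⟩

theorem IsRegularAt.differentiableAt_GRed (h : P.IsRegularAt zs) (i : Fin nv) (j : P.MulIdx zs) :
    DifferentiableAt ℝ (fun v => P.GRed zs v i j) zs.1 := by
  rcases j with j | j
  · exact h.differentiableAt_G i j
  · exact h.differentiableAt_H i j.1

theorem IsRegularAt.differentiableAt_GRed_mulVec (h : P.IsRegularAt zs) (m : P.MulIdx zs → ℝ) :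
    DifferentiableAt ℝ (fun v => P.GRed zs v *ᵥ m) zs.1 := by
  rw [differentiableAt_pi]
  intro i
  have hs : DifferentiableAt ℝ (fun v => ∑ j, P.GRed zs v i j * m j) zs.1 :=
    DifferentiableAt.fun_sum fun j _ => (h.differentiableAt_GRed i j).mul_const _
  exact hs

theorem IsRegularAt.differentiable_gRed (h : P.IsRegularAt zs) : Differentiable ℝ (P.gRed zs) := by
  rw [differentiable_pi]
  rintro (j | j)
  · exact differentiable_pi.mp (h.contDiff_g.differentiable (by norm_num)) j
  · exact differentiable_pi.mp (h.contDiff_h.differentiable (by norm_num)) j.1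

theorem IsRegularAt.continuousAt_GRed (h : P.IsRegularAt zs) (i : Fin nv) (j : P.MulIdx zs) :
    ContinuousAt (fun z : PrimalDual nv ng nh => P.GRed zs z.1 i j) zs :=
  ContinuousAt.comp (f := Prod.fst) (h.differentiableAt_GRed i j).continuousAt continuousAt_fst

theorem IsRegularAt.continuousAt_kktMatrix (h : P.IsRegularAt zs) : ContinuousAt (P.kktMatrix zs) zs := by
  refine continuousAt_pi.mpr fun i => continuousAt_pi.mpr fun j => ?_
  rcases i with i | i <;> rcases j with j | j
  · exact h.continuousAt_W i j
  · exact h.continuousAt_GRed i j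
  · exact h.continuousAt_GRed j i
  · exact continuousAt_const

variable (P zs)

/-- The inclusion of the reduced multipliers into the reduced primal-dual vectors. -/
def mulInclusion : (P.MulIdx zs → ℝ) →L[ℝ] (P.RedIdx zs → ℝ) :=
  ContinuousLinearMap.pi (Sum.elim (fun _ => 0) fun j => ContinuousLinearMap.proj j)

theorem mulInclusion_apply (m : P.MulIdx zs → ℝ) :
    P.mulInclusion zs m = Sum.elim (0 : Fin nv → ℝ) m := by
  funext i; rcases i with i | i <;> rfl

/-- The derivative at `zs` of the residual at `redPoint` with respect to the full vector `z`. -/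
def qpResidualDeriv : PrimalDual nv ng nh →L[ℝ] (P.RedIdx zs → ℝ) :=
  ContinuousLinearMap.pi (Sum.elim
    (fun i => (ContinuousLinearMap.proj i).comp
      (fderiv ℝ P.q zs + (fderiv ℝ (fun v => P.GRed zs v *ᵥ P.redMul zs) zs.1
        - LinearMap.toContinuousLinearMap (P.W zs).mulVecLin).comp (ContinuousLinearMap.fst ℝ _ _)))
    (fun j => (ContinuousLinearMap.proj j).comp
      ((fderiv ℝ (P.gRed zs) zs.1
        - LinearMap.toContinuousLinearMap (P.GRed zs zs.1)ᵀ.mulVecLin).comp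
          (ContinuousLinearMap.fst ℝ _ _))))

variable {P zs}

/-- With the first argument frozen at `redPoint`, both `W` and `G̃ᵀ` multiply v⋆ - v, which vanishes
at `zs`. They therefore contribute only their values there, through the terms -W⋆ and -G̃⋆ᵀ. -/
theorem IsRegularAt.hasFDerivAt_qpResidual (h : P.IsRegularAt zs) :
    HasFDerivAt (P.qpResidual zs (P.redPoint zs)) (P.qpResidualDeriv zs) zs := by
  have hfst : HasFDerivAt (fun z : PrimalDual nv ng nh => z.1) (ContinuousLinearMap.fst ℝ _ _) zs :=
    hasFDerivAt_fst
  have hu : HasFDerivAt (fun z : PrimalDual nv ng nh => zs.1 - z.1)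
      (-ContinuousLinearMap.fst ℝ _ _) zs := hfst.const_sub zs.1
  have h1 := hu.mulVec_of_continuousAt_of_eq_zero h.continuousAt_W (sub_self _)
  have h2 := hu.mulVec_of_continuousAt_of_eq_zero (A := fun z => (P.GRed zs z.1)ᵀ)
    (fun i j => by simpa using h.continuousAt_GRed j i) (sub_self _)
  have h3 := HasFDerivAt.comp zs
    (h.differentiableAt_GRed_mulVec (P.redMul zs)).hasFDerivAt hfst
  have h4 := HasFDerivAt.comp zs (h.differentiable_gRed zs.1).hasFDerivAt hfst
  have h5 := (h1.add h.differentiableAt_q.hasFDerivAt).add h3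
  have h6 := h4.add h2
  rw [hasFDerivAt_pi']
  rintro (i | j)
  · convert! hasFDerivAt_pi'.mp h5 i using 1
    refine ContinuousLinearMap.ext fun d => ?_
    simp [qpResidualDeriv]
    ring
  · convert! hasFDerivAt_pi'.mp h6 j using 1
    refine ContinuousLinearMap.ext fun d => ?_
    simp [qpResidualDeriv]
    ring

/-- On the range of `extend` the full derivative of `q` splits into the partial derivatives in v and
λ̃ that occur in `E` and `D`. Derivatives along inactive multipliers do not enter. -/
theorem IsRegularAt.qpResidualDeriv_extend (h : P.IsRegularAt zs)
    (hf : P.IsFixedPoint zs) (d : P.RedIdx zs → ℝ) :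
    P.qpResidualDeriv zs (P.extend zs d) = P.L zs *ᵥ d := by
  have hq := h.differentiableAt_q.hasFDerivAt
  have hE : fderiv ℝ (fun v => P.q (v, zs.2)) zs.1
      = (fderiv ℝ P.q zs).comp (ContinuousLinearMap.inl ℝ _ _) :=
    (HasFDerivAt.comp (g := P.q) zs.1 hq (hasFDerivAt_prodMk_left zs.1 zs.2)).fderiv
  have hD : fderiv ℝ (fun m => P.q (P.extend zs (Sum.elim zs.1 m))) (P.redMul zs)
      = (fderiv ℝ P.q zs).comp ((P.extendCLM zs).comp (P.mulInclusion zs)) := by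
    have hs : HasFDerivAt (fun m : P.MulIdx zs → ℝ => (Sum.elim zs.1 m : P.RedIdx zs → ℝ))
        (P.mulInclusion zs) (P.redMul zs) := by
      rw [hasFDerivAt_pi']
      rintro (i | j)
      · exact hasFDerivAt_const _ _
      · exact hasFDerivAt_apply j _
    refine (HasFDerivAt.comp (g := P.q) (P.redMul zs) ?_
      ((P.extendCLM zs).hasFDerivAt.comp _ hs)).fderiv
    have : ((P.extendCLM zs) ∘ fun m => Sum.elim zs.1 m) (P.redMul zs) = zs := hf.extend_redPoint
    rw [this]
    exact hq
  have hsplit : P.extend zs d = ContinuousLinearMap.inl ℝ _ _ (d ∘ Sum.inl)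
      + P.extend zs (Sum.elim (0 : Fin nv → ℝ) (d ∘ Sum.inr)) := by
    refine Prod.ext ?_ (Prod.ext ?_ ?_) <;> funext i <;> simp [extend]
  have h1 : fderiv ℝ P.q zs (P.extend zs d) =
      jacobianMatrix (fun v => P.q (v, zs.2)) zs.1 *ᵥ (d ∘ Sum.inl)
        + P.D zs *ᵥ (d ∘ Sum.inr) := by
    rw [D, jacobianMatrix_mulVec, jacobianMatrix_mulVec, hE, hD, hsplit, map_add]
    simp only [ContinuousLinearMap.comp_apply, extendCLM_apply, mulInclusion_apply]
  rw [L, fromBlocks_mulVec]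
  funext i
  rcases i with i | i
  · have := congrFun h1 i
    simp only [qpResidualDeriv, ContinuousLinearMap.pi_apply, Sum.elim_inl,
      ContinuousLinearMap.comp_apply, ContinuousLinearMap.proj_apply, _root_.add_apply,
      _root_.sub_apply, Pi.add_apply, E, sub_mulVec, add_mulVec, this,
      jacobianMatrix_mulVec (fun v => P.GRed zs v *ᵥ P.redMul zs)]
    simp only [LinearMap.coe_toContinuousLinearMap', mulVecLin_apply, Pi.sub_apply, Pi.add_apply]
    change _ + (fderiv ℝ (fun v => P.GRed zs v *ᵥ P.redMul zs) zs.1 (d ∘ Sum.inl) i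
      - (P.W zs *ᵥ (d ∘ Sum.inl)) i) = _
    ring
  · simp only [qpResidualDeriv, C, sub_mulVec, jacobianMatrix_mulVec, zero_mulVec, add_zero]
    rfl

theorem IsFixedPoint.hasFDerivAt_residual_left (hf : P.IsFixedPoint zs) :
    HasFDerivAt (fun x => P.residual zs x (P.redPoint zs))
      (LinearMap.toContinuousLinearMap (Matrix.toLin' (P.K zs))) (P.redPoint zs) := by
  have h1 : (fun x => P.residual zs x (P.redPoint zs))
      = fun x => (P.qpResidual zs 0 zs)
        + LinearMap.toContinuousLinearMap (Matrix.toLin' (P.K zs)) x := by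
    funext x
    rw [residual_eq_qpResidual, hf.extend_redPoint, P.qpResidual_eq_add zs x 0, sub_zero]
    rfl
  rw [h1]
  exact (ContinuousLinearMap.hasFDerivAt _).const_add _

theorem IsRegularAt.hasFDerivAt_residual_right (h : P.IsRegularAt zs)
    (hf : P.IsFixedPoint zs) :
    HasFDerivAt (fun y => P.residual zs (P.redPoint zs) y)
      (LinearMap.toContinuousLinearMap (Matrix.toLin' (P.L zs))) (P.redPoint zs) := by
  have h1 : HasFDerivAt (P.qpResidual zs (P.redPoint zs)) (P.qpResidualDeriv zs)
      (P.extendCLM zs (P.redPoint zs)) := by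
    rw [extendCLM_apply, hf.extend_redPoint]; exact h.hasFDerivAt_qpResidual
  have h2 := h1.comp (P.redPoint zs) (P.extendCLM zs).hasFDerivAt
  convert! h2 using 1
  ext d : 1
  exact (h.qpResidualDeriv_extend hf d).symm

variable (P zs)

/-- The step from `redPoint` to the solution of the reduced linear KKT system of the QP at `z`. -/
def redStep (z : PrimalDual nv ng nh) : P.RedIdx zs → ℝ :=
  (P.kktMatrix zs z)⁻¹ *ᵥ -P.qpResidual zs (P.redPoint zs) z

/-- The derivative of `redStep` at `zs`. -/
def redStepDeriv : PrimalDual nv ng nh →L[ℝ] (P.RedIdx zs → ℝ) :=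
  (LinearMap.toContinuousLinearMap (P.K zs)⁻¹.mulVecLin).comp (-P.qpResidualDeriv zs)

variable {P zs}

/-- The inverse matrix is only continuous at `zs`, which suffices because the residual it multiplies
is zero there. -/
theorem hasFDerivAt_redStep (h : P.IsRegularAt zs) (hf : P.RegularFixedPoint zs) :
    HasFDerivAt (P.redStep zs) (P.redStepDeriv zs) zs :=
  h.hasFDerivAt_qpResidual.neg.mulVec_of_continuousAt_of_eq_zero
    (fun i j => h.continuousAt_kktMatrix.matrix_inv_apply (isUnit_K hf) i j)
    (by simp [hf.fixed.qpResidual_eq_zero])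

theorem redStep_self (hf : P.IsFixedPoint zs) : P.redStep zs zs = 0 := by
  simp [redStep, hf.qpResidual_eq_zero]

theorem redStepDeriv_extend (h : P.IsRegularAt zs) (hf : P.IsFixedPoint zs)
    (y : P.RedIdx zs → ℝ) :
    P.redStepDeriv zs (P.extend zs y) = -(P.iterationMatrix zs *ᵥ y) := by
  simp [redStepDeriv, h.qpResidualDeriv_extend hf, iterationMatrix]

/-- Close to a regular fixed point the QP has exactly one KKT point, which is obtained from the
reduced linear system. -/
theorem eventually_isKKT_iff (h : P.IsRegularAt zs) (hf : P.RegularFixedPoint zs) :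
    ∀ᶠ z in 𝓝 zs, ∀ w, (P.localQP z).IsKKT w ↔ w = zs + P.extend zs (P.redStep zs z) := by
  have hK : ∀ᶠ z in 𝓝 zs, IsUnit (P.kktMatrix zs z) := by
    have hc : ContinuousAt (fun z => (P.kktMatrix zs z).det) zs :=
      (continuous_id.matrix_det).continuousAt.comp h.continuousAt_kktMatrix
    have h0 : (P.kktMatrix zs zs).det ≠ 0 :=
      ((isUnit_iff_isUnit_det _).mp (isUnit_K hf)).ne_zero
    filter_upwards [hc.eventually_ne h0] with z hz
    exact (isUnit_iff_isUnit_det _).mpr hz.isUnit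
  have hx : ContinuousAt (fun z => zs + P.extend zs (P.redStep zs z)) zs :=
    continuousAt_const.add ((P.extendCLM zs).continuous.continuousAt.comp
      (hasFDerivAt_redStep h hf).continuousAt)
  have hx0 : zs + P.extend zs (P.redStep zs zs) = zs := by
    rw [redStep_self hf.fixed, ← extendCLM_apply, map_zero, add_zero]
  have hpos : ∀ᶠ z in 𝓝 zs, ∀ i ∈ P.act zs, 0 < (zs + P.extend zs (P.redStep zs z)).2.2 i := by
    rw [Filter.eventually_all_finset]
    intro i hi
    have hc : ContinuousAt (fun z => (zs + P.extend zs (P.redStep zs z)).2.2 i) zs :=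
      continuousAt_pi.mp (continuousAt_snd.comp (continuousAt_snd.comp hx)) i
    refine hc.eventually_const_lt ?_
    simp only [hx0]
    exact hf.strict i hi
  have hneg : ∀ᶠ z in 𝓝 zs, ∀ i, i ∉ P.act zs →
      (P.localQP z).ineqVal (zs + P.extend zs (P.redStep zs z)).1 i < 0 := by
    rw [Filter.eventually_all]
    intro i
    by_cases hi : i ∈ P.act zs
    · exact Eventually.of_forall fun z hz => absurd hi hz
    have h1 : ContinuousAt (fun z : PrimalDual nv ng nh => P.h z.1 i) zs :=
      (((continuous_apply i).comp h.contDiff_h.continuous).comp continuous_fst).continuousAt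
    have h2 : ContinuousAt (fun z : PrimalDual nv ng nh =>
        ∑ j, P.H z.1 j i * ((zs + P.extend zs (P.redStep zs z)).1 j - z.1 j)) zs := by
      refine tendsto_finsetSum _ fun j _ => ?_
      refine ContinuousAt.mul (ContinuousAt.comp (f := Prod.fst)
        (h.differentiableAt_H j i).continuousAt continuousAt_fst) ?_
      exact (continuousAt_pi.mp (continuousAt_fst.comp hx) j).sub
        ((continuous_apply j).comp continuous_fst).continuousAt
    have hc : ContinuousAt (fun z => (P.localQP z).ineqVal
        (zs + P.extend zs (P.redStep zs z)).1 i) zs := h1.add h2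
    have hlt : (P.localQP zs).ineqVal (zs + P.extend zs (P.redStep zs zs)).1 i < 0 := by
      rw [hx0]
      refine lt_of_le_of_ne (hf.fixed.primal_ineq i) ?_
      simpa [act, QP.active] using hi
    filter_upwards [hc.eventually_lt_const hlt] with z hz _ using hz
  filter_upwards [hK, hpos, hneg] with z hKz hposz hnegz w
  have he : zs + P.extend zs (P.redStep zs z)
      = P.extend zs (P.redPoint zs + P.redStep zs z) := by
    rw [← extendCLM_apply, ← extendCLM_apply, map_add, extendCLM_apply, extendCLM_apply,
      hf.fixed.extend_redPoint]
  rw [he] at hposz hnegz ⊢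
  refine isKKT_iff_eq_extend (h.posSemidef_W z) hKz ?_ hposz hnegz
  rw [P.qpResidual_eq_add zs _ (P.redPoint zs), add_sub_cancel_left, redStep, mulVec_mulVec,
    mul_nonsing_inv _ ((isUnit_iff_isUnit_det _).mp hKz), one_mulVec, add_neg_cancel]

end SQPMethod

/-! ### Adapted norms and spectral splittings -/

section Spectral

variable {E : Type*} [NormedAddCommGroup E] [NormedSpace ℂ E]

/-- The sum of the generalized eigenspaces for the eigenvalues in `A`. -/
def Module.End.spectralSubspace (T : Module.End ℂ E) (A : Set ℂ) : Submodule ℂ E :=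
  ⨆ μ ∈ A, T.maxGenEigenspace μ

theorem Module.End.maxGenEigenspace_le_spectralSubspace (T : Module.End ℂ E) {A : Set ℂ} {μ : ℂ}
    (hμ : μ ∈ A) : T.maxGenEigenspace μ ≤ T.spectralSubspace A :=
  le_iSup₂ (f := fun μ (_ : μ ∈ A) => T.maxGenEigenspace μ) μ hμ

theorem Module.End.apply_mem_spectralSubspace (T : Module.End ℂ E) (A : Set ℂ) :
    ∀ x ∈ T.spectralSubspace A, T x ∈ T.spectralSubspace A := by
  have h : T.spectralSubspace A ≤ (T.spectralSubspace A).comap T :=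
    iSup₂_le fun μ hμ x hx => T.maxGenEigenspace_le_spectralSubspace hμ
      (T.mapsTo_maxGenEigenspace_of_comm (Commute.refl T) μ hx)
  exact h

variable [FiniteDimensional ℂ E]

/-- If all eigenvalues of `T` have modulus less than `r`, then some power of `T` has operator norm
at most the corresponding power of `r`. -/
theorem Module.End.exists_norm_pow_apply_le (T : Module.End ℂ E) {r : ℝ} (hr : 0 < r)
    (h : ∀ μ, T.HasEigenvalue μ → ‖μ‖ < r) :
    ∃ n : ℕ, 0 < n ∧ ∀ x, ‖(T ^ n) x‖ ≤ r ^ n * ‖x‖ := by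
  rcases subsingleton_or_nontrivial E with hE | hE
  · exact ⟨1, one_pos, fun x => by simp [Subsingleton.elim x 0]⟩
  have : CompleteSpace E := FiniteDimensional.complete ℂ E
  set a : E →L[ℂ] E := Module.End.toContinuousLinearMap E T with ha
  have hsp : spectrum ℂ a = spectrum ℂ T := AlgEquiv.spectrum_eq _ T
  have hρ : spectralRadius ℂ a < (r.toNNReal : ENNReal) := by
    refine spectrum.spectralRadius_lt_of_forall_lt a fun μ hμ => ?_
    rw [hsp, ← Module.End.hasEigenvalue_iff_mem_spectrum] at hμ
    rw [← NNReal.coe_lt_coe, coe_nnnorm, Real.coe_toNNReal _ hr.le]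
    exact h μ hμ
  -- Gelfand's formula; a positive exponent is chosen so that the n-th root can be undone.
  have hev := (spectrum.pow_nnnorm_pow_one_div_tendsto_nhds_spectralRadius a).eventually_lt_const hρ
  obtain ⟨n, hn, hn0⟩ := (hev.and (eventually_gt_atTop 0)).exists
  refine ⟨n, hn0, fun x => ?_⟩
  have h1 : (‖a ^ n‖₊ : ENNReal) ≤ (r.toNNReal : ENNReal) ^ n := by
    have h2 := ENNReal.rpow_le_rpow hn.le (Nat.cast_nonneg n)
    rwa [← ENNReal.rpow_mul, one_div, inv_mul_cancel₀ (by exact_mod_cast hn0.ne'),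
      ENNReal.rpow_one, ENNReal.rpow_natCast] at h2
  have h3 : ‖a ^ n‖ ≤ r ^ n := by
    have h4 : ‖a ^ n‖₊ ≤ r.toNNReal ^ n := by exact_mod_cast h1
    simpa [Real.coe_toNNReal _ hr.le] using NNReal.coe_le_coe.mpr h4
  have h5 : (T ^ n) x = (a ^ n) x := by
    rw [ha, ← map_pow]; rfl
  rw [h5]
  exact ((a ^ n).le_opNorm x).trans (by gcongr)

/-- An adapted norm: if all eigenvalues of `T` have modulus less than `r`, then `T` contracts by
the factor `r` in some norm. -/
theorem Module.End.exists_seminorm_apply_le (T : Module.End ℂ E) {r : ℝ} (hr : 0 < r)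
    (h : ∀ μ, T.HasEigenvalue μ → ‖μ‖ < r) :
    ∃ N : Seminorm ℂ E, (∀ x, ‖x‖ ≤ N x) ∧ ∀ x, N (T x) ≤ r * N x := by
  obtain ⟨n, hn, hT⟩ := T.exists_norm_pow_apply_le hr h
  -- Applying T shifts this sum by one index and multiplies it by r. The term gained at index n is
  -- at most the term lost at index 0, by the choice of n.
  let N : Seminorm ℂ E := Seminorm.of (fun x => ∑ k ∈ Finset.range n, r⁻¹ ^ k * ‖(T ^ k) x‖)
    (fun x y => by
      rw [← Finset.sum_add_distrib]
      refine Finset.sum_le_sum fun k _ => ?_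
      rw [← mul_add, map_add]
      exact mul_le_mul_of_nonneg_left (norm_add_le _ _) (by positivity))
    (fun c x => by
      rw [Finset.mul_sum]
      refine Finset.sum_congr rfl fun k _ => ?_
      rw [map_smul, norm_smul]
      ring)
  have happ : ∀ x, N x = ∑ k ∈ Finset.range n, r⁻¹ ^ k * ‖(T ^ k) x‖ := fun x => rfl
  refine ⟨N, fun x => ?_, fun x => ?_⟩
  · rw [happ]
    refine le_trans ?_ (Finset.single_le_sum (f := fun k => r⁻¹ ^ k * ‖(T ^ k) x‖)
      (fun k _ => by positivity) (Finset.mem_range.mpr hn))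
    simp
  · have hshift : ∀ k, r⁻¹ ^ k * ‖(T ^ k) (T x)‖ = r * (r⁻¹ ^ (k + 1) * ‖(T ^ (k + 1)) x‖) := by
      intro k
      rw [pow_succ T k, Module.End.mul_apply, pow_succ]
      field_simp
    rw [happ, happ, Finset.sum_congr rfl fun k _ => hshift k, ← Finset.mul_sum]
    refine mul_le_mul_of_nonneg_left ?_ hr.le
    have h1 := Finset.sum_range_succ (fun k => r⁻¹ ^ k * ‖(T ^ k) x‖) n
    have h2 := Finset.sum_range_succ' (fun k => r⁻¹ ^ k * ‖(T ^ k) x‖) n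
    have h3 : r⁻¹ ^ n * ‖(T ^ n) x‖ ≤ ‖x‖ := by
      rw [inv_pow, inv_mul_le_iff₀ (by positivity)]
      exact hT x
    simp only [pow_zero, Module.End.one_apply, one_mul] at h2
    linarith

theorem Module.End.isCompl_spectralSubspace (T : Module.End ℂ E) (A : Set ℂ) :
    IsCompl (T.spectralSubspace A) (T.spectralSubspace Aᶜ) := by
  refine ⟨T.independent_maxGenEigenspace.disjoint_biSup_biSup disjoint_compl_right, ?_⟩
  rw [codisjoint_iff, eq_top_iff, ← T.iSup_maxGenEigenspace_eq_top]
  refine iSup_le fun μ => ?_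
  by_cases hμ : μ ∈ A
  · exact (T.maxGenEigenspace_le_spectralSubspace hμ).trans le_sup_left
  · exact (T.maxGenEigenspace_le_spectralSubspace (A := Aᶜ) hμ).trans le_sup_right

/-- An eigenvector in the subspace for `A` with eigenvalue outside `A` would also lie in the
complementary subspace. -/
theorem Module.End.hasEigenvalue_restrict_spectralSubspace (T : Module.End ℂ E) (A : Set ℂ) {μ : ℂ}
    (hμ : HasEigenvalue (T.restrict (T.apply_mem_spectralSubspace A)) μ) :
    μ ∈ A ∧ T.HasEigenvalue μ := by
  obtain ⟨⟨x, hxA⟩, hx⟩ := hμ.exists_hasEigenvector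
  have hx0 : x ≠ 0 := fun h0 => hx.2 (Subtype.ext h0)
  have hTx : T x = μ • x := congrArg Subtype.val hx.apply_eq_smul
  have hmem : x ∈ T.eigenspace μ := mem_eigenspace_iff.mpr hTx
  refine ⟨?_, hasEigenvalue_of_hasEigenvector ⟨hmem, hx0⟩⟩
  by_contra hA
  refine hx0 (Submodule.disjoint_def.mp (T.isCompl_spectralSubspace A).disjoint x hxA ?_)
  exact T.maxGenEigenspace_le_spectralSubspace (A := Aᶜ) hA
    ((T.genEigenspace μ).monotone le_top hmem)

/-- Dominated splitting: above any `r` less than the modulus of an eigenvalue, the space splits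
into an expanding and a dominated part, measured by two seminorms. -/
theorem Module.End.exists_dominated_splitting (T : Module.End ℂ E) {r : ℝ} (hr : 0 ≤ r) {μ₀ : ℂ}
    (hμ₀ : T.HasEigenvalue μ₀) (hrμ : r < ‖μ₀‖) :
    ∃ (Nu Ns : Seminorm ℂ E) (a b : ℝ), 0 ≤ b ∧ b < a ∧ r < a ∧
      (∀ x, a * Nu x ≤ Nu (T x)) ∧ (∀ x, Ns (T x) ≤ b * Ns x) ∧
      (∀ x, ‖x‖ ≤ Nu x + Ns x) ∧ ∃ x, Nu x ≠ 0 := by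
  set κ := ‖μ₀‖ with hκ
  have hfin : {μ | T.HasEigenvalue μ}.Finite := by
    simp only [Module.End.hasEigenvalue_iff_mem_spectrum]
    exact Module.End.finite_spectrum T
  -- There are finitely many eigenvalues, so the moduli below κ leave a gap under κ. Both b and a
  -- are taken from it, above r.
  obtain ⟨b, hrb, hbκ, hb⟩ : ∃ b, r < b ∧ b < κ ∧ ∀ μ, T.HasEigenvalue μ → ‖μ‖ < κ → ‖μ‖ < b := by
    have h1 : ∀ᶠ b in 𝓝[<] κ, ∀ μ ∈ {μ | T.HasEigenvalue μ}, ‖μ‖ < κ → ‖μ‖ < b := by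
      rw [hfin.eventually_all]
      intro μ _
      by_cases h : ‖μ‖ < κ
      · filter_upwards [Ioo_mem_nhdsLT h] with b hb _ using hb.1
      · exact Eventually.of_forall fun _ h' => absurd h' h
    obtain ⟨b, hb1, hb2⟩ := (h1.and (Ioo_mem_nhdsLT hrμ)).exists
    exact ⟨b, hb2.1, hb2.2, hb1⟩
  obtain ⟨a, hba, haκ⟩ := exists_between hbκ
  have hb0 : 0 < b := hr.trans_lt hrb
  have ha0 : 0 < a := hb0.trans hba
  set A : Set ℂ := {μ | κ ≤ ‖μ‖} with hA
  set U := T.spectralSubspace A with hU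
  set S := T.spectralSubspace Aᶜ with hS
  have hUS : IsCompl U S := T.isCompl_spectralSubspace A
  set TU : Module.End ℂ U := T.restrict (T.apply_mem_spectralSubspace A) with hTU
  set TS : Module.End ℂ S := T.restrict (T.apply_mem_spectralSubspace Aᶜ) with hTS
  obtain ⟨NS, hNS1, hNS2⟩ := TS.exists_seminorm_apply_le hb0 fun μ hμ => by
    obtain ⟨h1, h2⟩ := T.hasEigenvalue_restrict_spectralSubspace Aᶜ hμ
    exact hb μ h2 (not_le.mp h1)
  have hinj : Function.Injective TU := by
    refine (injective_iff_map_eq_zero TU).mpr fun x hx => ?_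
    by_contra hx0
    have h0 : TU.HasEigenvalue 0 := hasEigenvalue_of_hasEigenvector (x := x)
      ⟨mem_eigenspace_iff.mpr (by rw [hx, zero_smul]), hx0⟩
    have := (T.hasEigenvalue_restrict_spectralSubspace A h0).1
    simp only [hA, Set.mem_ofPred_eq, norm_zero] at this
    linarith
  set e := LinearEquiv.ofInjectiveEndo TU hinj with he
  have hTe : ∀ x, TU (e.symm x) = x := fun x => e.apply_symm_apply x
  -- Expansion by a is contraction of the inverse by a⁻¹: the eigenvalues of the inverse have
  -- modulus at most κ⁻¹ < a⁻¹.
  obtain ⟨NU, hNU1, hNU2⟩ := Module.End.exists_seminorm_apply_le (e.symm : Module.End ℂ U)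
    (inv_pos.mpr ha0) fun μ hμ => by
      obtain ⟨x, hx⟩ := hμ.exists_hasEigenvector
      have hx1 : e.symm x = μ • x := hx.apply_eq_smul
      have hx2 : x = μ • TU x := by rw [← map_smul, ← hx1, hTe]
      have hμ0 : μ ≠ 0 := fun h0 => hx.2 (by rw [hx2, h0, zero_smul])
      have hx3 : TU.HasEigenvalue μ⁻¹ := by
        refine hasEigenvalue_of_hasEigenvector (x := x) ⟨mem_eigenspace_iff.mpr ?_, hx.2⟩
        conv_rhs => rw [hx2]
        rw [smul_smul, inv_mul_cancel₀ hμ0, one_smul]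
      have h4 := (T.hasEigenvalue_restrict_spectralSubspace A hx3).1
      simp only [hA, Set.mem_ofPred_eq, norm_inv] at h4
      exact (lt_inv_comm₀ ha0 (norm_pos_iff.mpr hμ0)).mp (haκ.trans_le h4)
  have hPU : ∀ x, U.projectionOnto S hUS (T x) = TU (U.projectionOnto S hUS x) := by
    intro x
    obtain ⟨u, s, rfl⟩ : ∃ (u : U) (s : S), (u : E) + s = x := by
      obtain ⟨⟨u, s⟩, h, -⟩ := Submodule.existsUnique_add_of_isCompl_prod hUS x
      exact ⟨u, s, h⟩
    have h1 : T u = (TU u : E) := rfl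
    have h2 : T s = (TS s : E) := rfl
    simp only [map_add, h1, h2, Submodule.projectionOnto_apply_left,
      Submodule.projectionOnto_apply_right, add_zero]
  have hPS : ∀ x, S.projectionOnto U hUS.symm (T x) = TS (S.projectionOnto U hUS.symm x) := by
    intro x
    obtain ⟨u, s, rfl⟩ : ∃ (u : U) (s : S), (u : E) + s = x := by
      obtain ⟨⟨u, s⟩, h, -⟩ := Submodule.existsUnique_add_of_isCompl_prod hUS x
      exact ⟨u, s, h⟩
    have h1 : T u = (TU u : E) := rfl
    have h2 : T s = (TS s : E) := rfl
    simp only [map_add, h1, h2, Submodule.projectionOnto_apply_left,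
      Submodule.projectionOnto_apply_right, zero_add]
  refine ⟨NU.comp (U.projectionOnto S hUS), NS.comp (S.projectionOnto U hUS.symm), a, b, hb0.le,
    hba, hrb.trans hba, fun x => ?_, fun x => ?_, fun x => ?_, ?_⟩
  · have h1 := hNU2 (TU (U.projectionOnto S hUS x))
    have h2 : (e.symm : Module.End ℂ U) (TU (U.projectionOnto S hUS x))
        = U.projectionOnto S hUS x := e.symm_apply_apply _
    rw [h2, ← hPU, ← div_eq_inv_mul, le_div_iff₀ ha0, mul_comm] at h1
    exact h1
  · simp only [Seminorm.comp_apply, hPS]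
    exact hNS2 _
  · have h1 := Submodule.projection_add_projection_eq_self hUS x
    rw [← Submodule.coe_projectionOnto_apply, ← Submodule.coe_projectionOnto_apply] at h1
    calc ‖x‖ ≤ ‖U.projectionOnto S hUS x‖ + ‖S.projectionOnto U hUS.symm x‖ := by
          conv_lhs => rw [← h1]
          exact norm_add_le _ _
      _ ≤ _ := add_le_add (hNU1 _) (hNS1 _)
  · obtain ⟨x, hx⟩ := hμ₀.exists_hasEigenvector
    have hxU : x ∈ U := T.maxGenEigenspace_le_spectralSubspace (A := A) (show κ ≤ ‖μ₀‖ from le_rfl)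
      ((T.genEigenspace μ₀).monotone le_top hx.1)
    refine ⟨x, fun h0 => hx.2 ?_⟩
    have h1 := hNU1 ⟨x, hxU⟩
    rw [Seminorm.comp_apply, Submodule.projectionOnto_apply_of_mem_left hUS hxU] at h0
    rw [h0] at h1
    exact norm_le_zero_iff.mp h1

end Spectral

/-! ### Transfer to real matrices by complexification -/

section RealMatrix

variable {m : Type*} [Fintype m]

/-- The inclusion of the real vectors into the complex vectors. -/
def complexInclusion (m : Type*) : (m → ℝ) →ₗ[ℝ] (m → ℂ) where
  toFun y i := y i
  map_add' x y := by funext i; simp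
  map_smul' c x := by funext i; simp

theorem norm_complexInclusion (y : m → ℝ) : ‖complexInclusion m y‖ = ‖y‖ := by
  simp [complexInclusion, Pi.norm_def]

variable [DecidableEq m]

theorem toLin'_map_complexInclusion (A : Matrix m m ℝ) (y : m → ℝ) :
    Matrix.toLin' (A.map (algebraMap ℝ ℂ)) (complexInclusion m y)
      = complexInclusion m (A *ᵥ y) := by
  funext i
  simp [complexInclusion, mulVec, dotProduct]

theorem Matrix.hasEigenvalue_toLin'_iff (A : Matrix m m ℂ) (μ : ℂ) :
    Module.End.HasEigenvalue A.toLin' μ ↔ μ ∈ spectrum ℂ A := by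
  rw [Module.End.hasEigenvalue_iff_mem_spectrum, spectrum_toLin']

/-- Ensures that `toReal`, which sends `⊤` to 0, loses nothing in the definition of `kappa`. -/
theorem Matrix.spectralRadius_ne_top (A : Matrix m m ℂ) : spectralRadius ℂ A ≠ ⊤ := by
  obtain ⟨C, hC⟩ := (A.finite_spectrum.image fun μ => ‖μ‖₊).bddAbove
  refine ne_top_of_le_ne_top ENNReal.coe_ne_top (b := (C : ENNReal)) ?_
  exact iSup₂_le fun μ hμ => ENNReal.coe_le_coe.mpr (hC ⟨μ, hμ, rfl⟩)

theorem Matrix.exists_seminorm_mulVec_le (A : Matrix m m ℝ) {r : ℝ}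
    (hr : (spectralRadius ℂ (A.map (algebraMap ℝ ℂ))).toReal < r) :
    ∃ N : Seminorm ℝ (m → ℝ), (∀ y, ‖y‖ ≤ N y) ∧ ∀ y, N (A *ᵥ y) ≤ r * N y := by
  obtain ⟨N, hN1, hN2⟩ := Module.End.exists_seminorm_apply_le
    (Matrix.toLin' (A.map (algebraMap ℝ ℂ))) (ENNReal.toReal_nonneg.trans_lt hr) fun μ hμ => by
      rw [hasEigenvalue_toLin'_iff] at hμ
      refine lt_of_le_of_lt ?_ hr
      rw [← coe_nnnorm, ← ENNReal.coe_toReal]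
      exact ENNReal.toReal_mono (spectralRadius_ne_top _)
        (le_iSup₂ (f := fun μ (_ : μ ∈ spectrum ℂ (A.map (algebraMap ℝ ℂ))) => (‖μ‖₊ : ENNReal)) μ hμ)
  refine ⟨(N.restrictScalars ℝ).comp (complexInclusion m), fun y => ?_, fun y => ?_⟩
  · rw [← norm_complexInclusion y]; exact hN1 _
  · have := hN2 (complexInclusion m y)
    rw [toLin'_map_complexInclusion] at this
    exact this

theorem Matrix.exists_dominated_splitting (A : Matrix m m ℝ) {r : ℝ} (hr0 : 0 ≤ r)
    (hr : r < (spectralRadius ℂ (A.map (algebraMap ℝ ℂ))).toReal) :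
    ∃ (Nu Ns : Seminorm ℝ (m → ℝ)) (a b : ℝ), 0 ≤ b ∧ b < a ∧ r < a ∧
      (∀ y, a * Nu y ≤ Nu (A *ᵥ y)) ∧ (∀ y, Ns (A *ᵥ y) ≤ b * Ns y) ∧
      (∀ y, ‖y‖ ≤ Nu y + Ns y) ∧ ∃ y, Nu y ≠ 0 := by
  obtain ⟨μ, hμ, hrμ⟩ : ∃ μ ∈ spectrum ℂ (A.map (algebraMap ℝ ℂ)), r < ‖μ‖ := by
    have h1 : ENNReal.ofReal r < spectralRadius ℂ (A.map (algebraMap ℝ ℂ)) :=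
      (ENNReal.ofReal_lt_iff_lt_toReal hr0 (spectralRadius_ne_top _)).mpr hr
    obtain ⟨μ, h2⟩ := lt_iSup_iff.mp h1
    obtain ⟨hμ, h3⟩ := lt_iSup_iff.mp h2
    refine ⟨μ, hμ, ?_⟩
    rwa [ENNReal.ofReal_lt_iff_lt_toReal hr0 ENNReal.coe_ne_top] at h3
  obtain ⟨Nu, Ns, a, b, hb, hba, hra, hu, hs, hn, x, hx⟩ :=
    Module.End.exists_dominated_splitting (Matrix.toLin' (A.map (algebraMap ℝ ℂ))) hr0
      ((hasEigenvalue_toLin'_iff _ μ).mpr hμ) hrμ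
  refine ⟨(Nu.restrictScalars ℝ).comp (complexInclusion m),
    (Ns.restrictScalars ℝ).comp (complexInclusion m), a, b, hb, hba, hra, fun y => ?_, fun y => ?_,
    fun y => ?_, ?_⟩
  · have := hu (complexInclusion m y)
    rw [toLin'_map_complexInclusion] at this
    exact this
  · have := hs (complexInclusion m y)
    rw [toLin'_map_complexInclusion] at this
    exact this
  · rw [← norm_complexInclusion y]; exact hn _
  · by_contra! h0
    replace h0 : ∀ y, Nu (complexInclusion m y) = 0 := h0
    refine hx (le_antisymm ?_ (apply_nonneg Nu x))
    -- A complex seminorm vanishing on real vectors vanishes everywhere, by splitting into real and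
    -- imaginary parts.
    have hx2 : x = complexInclusion m (fun i => (x i).re)
        + Complex.I • complexInclusion m (fun i => (x i).im) := by
      funext i
      simp [complexInclusion, mul_comm Complex.I, Complex.re_add_im]
    rw [hx2]
    refine (map_add_le_add Nu _ _).trans_eq ?_
    rw [map_smul_eq_mul Nu, h0, h0, mul_zero, add_zero]

end RealMatrix

/-! ### Contraction and expansion near a fixed point -/

section Dynamics

theorem Seminorm.exists_le_mul_norm_pi {m : Type*} [Fintype m] (N : Seminorm ℝ (m → ℝ)) :
    ∃ C, 0 < C ∧ ∀ y, N y ≤ C * ‖y‖ := by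
  classical
  refine ⟨∑ i, N (Pi.single i 1) + 1, by positivity, fun y => ?_⟩
  have h1 : y = ∑ i, y i • (Pi.single i 1 : m → ℝ) := pi_eq_sum_univ' y
  have h2 : N y ≤ ∑ i, N (y i • (Pi.single i 1 : m → ℝ)) := by
    conv_lhs => rw [h1]
    exact Finset.le_sum_of_subadditive N (map_zero N).le (map_add_le_add N) _ _
  have h3 : ∀ i, N (y i • (Pi.single i 1 : m → ℝ)) ≤ N (Pi.single i 1) * ‖y‖ := fun i => by
    rw [map_smul_eq_mul, mul_comm]
    exact mul_le_mul_of_nonneg_left (norm_le_pi_norm y i) (apply_nonneg N _)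
  calc N y ≤ ∑ i, N (Pi.single i 1) * ‖y‖ := h2.trans (Finset.sum_le_sum fun i _ => h3 i)
    _ ≤ _ := by rw [← Finset.sum_mul, add_mul]; linarith [norm_nonneg y]

variable {X : Type} [NormedAddCommGroup X] [NormedSpace ℝ X]

/-- The differential of `f` at a fixed point bounds `f` in an adapted norm. -/
theorem HasFDerivAt.eventually_seminorm_le {f : X → X} {zs : X} {M : X →L[ℝ] X}
    (hf : HasFDerivAt f M zs) (h0 : f zs = zs) {N : Seminorm ℝ X} {c C b r : ℝ} (hc : 0 < c)
    (hC : 0 < C) (hNc : ∀ x, c * ‖x‖ ≤ N x) (hNC : ∀ x, N x ≤ C * ‖x‖)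
    (hM : ∀ x, N (M x) ≤ b * N x) (hbr : b < r) :
    ∀ᶠ z in 𝓝 zs, N (f z - zs) ≤ r * N (z - zs) := by
  have hε : 0 < (r - b) * c / C := by have := sub_pos.mpr hbr; positivity
  filter_upwards [hf.isLittleO.bound hε] with z hz
  rw [h0] at hz
  calc N (f z - zs) = N ((f z - zs - M (z - zs)) + M (z - zs)) := by rw [sub_add_cancel]
    _ ≤ N (f z - zs - M (z - zs)) + N (M (z - zs)) := map_add_le_add N _ _
    _ ≤ (r - b) * N (z - zs) + b * N (z - zs) := by
        refine add_le_add ?_ (hM _)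
        calc _ ≤ C * ((r - b) * c / C * ‖z - zs‖) :=
              (hNC _).trans (mul_le_mul_of_nonneg_left hz hC.le)
          _ = (r - b) * (c * ‖z - zs‖) := by field_simp
          _ ≤ _ := mul_le_mul_of_nonneg_left (hNc _) (sub_pos.mpr hbr).le
    _ = r * N (z - zs) := by ring

/-- In the norm `N`, equivalent to that of `X`, the map `f` contracts towards `zs` by the
factor `r` close to `zs`. -/
structure ContractsNear (f : X → X) (zs : X) (N : Seminorm ℝ X) (r : ℝ) : Prop where
  lower : ∃ c, 0 < c ∧ ∀ x, c * ‖x‖ ≤ N x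
  upper : ∃ C, 0 < C ∧ ∀ x, N x ≤ C * ‖x‖
  step : ∀ᶠ z in 𝓝 zs, N (f z - zs) ≤ r * N (z - zs)

namespace ContractsNear

variable {f : X → X} {zs : X} {N : Seminorm ℝ X} {r : ℝ}

/-- The sublevel set N(z - zs) < cε lies in the ε-ball where the contraction holds, so r < 1 makes
it invariant; the ball of radius cε/C lies inside it. -/
theorem exists_invariant (h : ContractsNear f zs N r) (hr1 : r < 1) {V : Set X}
    (hV : V ∈ 𝓝 zs) :
    ∃ U ∈ 𝓝 zs, ∀ z₀ ∈ U, ∀ k : ℕ,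
      f^[k] z₀ ∈ V ∧ N (f^[k + 1] z₀ - zs) ≤ r * N (f^[k] z₀ - zs) := by
  obtain ⟨c, hc, hNc⟩ := h.lower
  obtain ⟨C, hC, hNC⟩ := h.upper
  obtain ⟨ε, hε, hball⟩ := Metric.eventually_nhds_iff_ball.mp (h.step.and hV)
  have hin : ∀ z, N (z - zs) < c * ε → z ∈ Metric.ball zs ε := fun z hz => by
    rw [mem_ball_iff_norm]
    exact lt_of_mul_lt_mul_left ((hNc _).trans_lt hz) hc.le
  refine ⟨Metric.ball zs (c * ε / C), Metric.ball_mem_nhds _ (by positivity), fun z₀ hz₀ => ?_⟩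
  have hstep : ∀ k : ℕ, N (f^[k] z₀ - zs) < c * ε := by
    intro k
    induction k with
    | zero =>
      rw [mem_ball_iff_norm, lt_div_iff₀ hC, mul_comm] at hz₀
      exact (hNC _).trans_lt hz₀
    | succ k ih =>
      rw [Function.iterate_succ_apply']
      refine ((hball _ (hin _ ih)).1.trans ?_).trans_lt ih
      exact mul_le_of_le_one_left (apply_nonneg N _) hr1.le
  intro k
  rw [Function.iterate_succ_apply']
  exact ⟨(hball _ (hin _ (hstep k))).2, (hball _ (hin _ (hstep k))).1⟩

theorem qLinearWithFactor (h : ContractsNear f zs N r) (hr1 : r < 1) :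
    QLinearWithFactor f zs r := by
  obtain ⟨c, hc, hNc⟩ := h.lower
  obtain ⟨U, hU, hk⟩ := h.exists_invariant hr1 univ_mem
  refine ⟨N, fun x hx => ?_, U, hU, fun z₀ hz₀ k => (hk z₀ hz₀ k).2⟩
  have := hNc x
  rw [hx] at this
  exact norm_le_zero_iff.mp (nonpos_of_mul_nonpos_right this hc)

theorem exists_isBigO (h : ContractsNear f zs N r) (hr0 : 0 ≤ r) (hr1 : r < 1) :
    ∃ U ∈ 𝓝 zs, ∀ z₀ ∈ U,
      (fun k : ℕ => f^[k] z₀ - zs) =O[atTop] (fun k : ℕ => r ^ k) := by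
  obtain ⟨c, hc, hNc⟩ := h.lower
  obtain ⟨U, hU, hk⟩ := h.exists_invariant hr1 univ_mem
  refine ⟨U, hU, fun z₀ hz₀ => ?_⟩
  have hpow : ∀ k : ℕ, N (f^[k] z₀ - zs) ≤ r ^ k * N (z₀ - zs) := by
    intro k
    induction k with
    | zero => simp
    | succ k ih =>
      refine (hk z₀ hz₀ k).2.trans ?_
      rw [pow_succ', mul_assoc]
      exact mul_le_mul_of_nonneg_left ih hr0
  refine IsBigO.of_bound (N (z₀ - zs) / c) (Eventually.of_forall fun k => ?_)
  rw [Real.norm_of_nonneg (pow_nonneg hr0 k), div_mul_eq_mul_div, le_div_iff₀ hc, mul_comm,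
    mul_comm (N _)]
  exact (hNc _).trans (hpow k)

theorem locallyConvergent (h : ContractsNear f zs N r) (hr0 : 0 ≤ r) (hr1 : r < 1) :
    LocallyConvergent f zs := by
  obtain ⟨U, hU, hk⟩ := h.exists_isBigO hr0 hr1
  refine ⟨U, hU, fun z₀ hz₀ => ?_⟩
  rw [tendsto_iff_norm_sub_tendsto_zero]
  exact ((hk z₀ hz₀).trans_tendsto (tendsto_pow_atTop_nhds_zero_of_lt_one hr0 hr1)).norm.trans
    (by simp)

end ContractsNear

/-- The neighbourhood in the little-o claim must not depend on r. The basin for the factor 1/2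
serves: every orbit in it eventually enters the smaller neighbourhood belonging to a factor below r,
and the finite shift costs only a constant. -/
theorem convergesSuperlinearly_of_contractsNear {f : X → X} {zs : X}
    (h : ∀ r, 0 < r → ∃ N, ContractsNear f zs N r) : ConvergesSuperlinearly f zs := by
  obtain ⟨N, hN⟩ := h (1 / 2) (by norm_num)
  obtain ⟨U, hU, hconv⟩ := hN.locallyConvergent (by norm_num) (by norm_num)
  refine ⟨⟨U, hU, hconv⟩, ⟨U, hU, fun z₀ hz₀ r hr => ?_⟩, fun r hr0 hr1 => ?_⟩
  · have hs0 : 0 < min r 1 / 2 := by positivity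
    have hsr : min r 1 / 2 < r := by have := min_le_left r 1; linarith
    have hs1 : min r 1 / 2 < 1 := by have := min_le_right r 1; linarith
    obtain ⟨N', hN'⟩ := h _ hs0
    obtain ⟨U', hU', hO⟩ := hN'.exists_isBigO hs0.le hs1
    obtain ⟨n, hn⟩ := ((hconv z₀ hz₀).eventually hU').exists
    have h1 : (fun k : ℕ => f^[k + n] z₀ - zs) =O[atTop] fun k : ℕ => (min r 1 / 2) ^ k := by
      simpa only [Function.iterate_add_apply] using hO _ hn
    have h2 := h1.trans_isLittleO (isLittleO_pow_pow_of_lt_left hs0.le hsr)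
    have h3 : (fun k : ℕ => r ^ k) =O[atTop] fun k : ℕ => r ^ (k + n) := by
      refine IsBigO.of_bound (r ^ n)⁻¹ (Eventually.of_forall fun k => ?_)
      rw [pow_add, norm_mul, Real.norm_of_nonneg (pow_nonneg hr.le n)]
      field_simp
      exact le_rfl
    have h4 := (h2.trans_isBigO h3).comp_tendsto (tendsto_sub_atTop_nat n)
    refine h4.congr' ?_ ?_ <;>
    · filter_upwards [eventually_ge_atTop n] with k hk
      simp [Nat.sub_add_cancel hk]
  · obtain ⟨N', hN'⟩ := h r hr0
    exact hN'.qLinearWithFactor hr1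

variable {m : Type*} [Fintype m] [DecidableEq m]

/-- Close to `zs` the map `f` factors as `z ↦ zs + i (F z)` through a space of reduced variables
on which the derivative of `F` acts as the matrix `-A`. -/
structure FactorsThrough (f : X → X) (zs : X) (A : Matrix m m ℝ) (i : (m → ℝ) →L[ℝ] X)
    (F : X → m → ℝ) (B : X →L[ℝ] (m → ℝ)) : Prop where
  eventually_eq : ∀ᶠ z in 𝓝 zs, f z = zs + i (F z)
  map_fixed : F zs = 0
  hasFDerivAt : HasFDerivAt F B zs
  deriv_apply : ∀ y, B (i y) = -(A *ᵥ y)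

namespace FactorsThrough

variable {f : X → X} {zs : X} {A : Matrix m m ℝ} {i : (m → ℝ) →L[ℝ] X} {F : X → m → ℝ}
  {B : X →L[ℝ] (m → ℝ)}

/-- The derivative of `f` is i ∘ B, while the spectral radius concerns B ∘ i = -A. The seminorm N ∘
B contracts by b, since B(i(Bx)) = -A(Bx), but it vanishes on ker B. Adding η‖x‖ makes it a norm,
and η is so small that the added term of the image is at most (s - b) N(Bx). -/
theorem exists_contractsNear (h : FactorsThrough f zs A i F B) {r : ℝ}
    (hr : (spectralRadius ℂ (A.map (algebraMap ℝ ℂ))).toReal < r) :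
    ∃ N, ContractsNear f zs N r := by
  obtain ⟨s, hs, hsr⟩ := exists_between hr
  obtain ⟨b, hb, hbs⟩ := exists_between hs
  obtain ⟨N, hN1, hN2⟩ := A.exists_seminorm_mulVec_le hb
  obtain ⟨C, hC, hNC⟩ := N.exists_le_mul_norm_pi
  set η : ℝ := (s - b) / (‖i‖ + 1) with hη
  have hη0 : 0 < η := div_pos (sub_pos.mpr hbs) (by positivity)
  let N' : Seminorm ℝ X := N.comp (B : X →ₗ[ℝ] m → ℝ) + η.toNNReal • normSeminorm ℝ X
  have hN' : ∀ x, N' x = N (B x) + η * ‖x‖ := fun x => by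
    change N (B x) + (η.toNNReal : ℝ) * ‖x‖ = _
    rw [Real.coe_toNNReal _ hη0.le]
  have hlow : ∀ x, η * ‖x‖ ≤ N' x := fun x => by
    rw [hN']; linarith [apply_nonneg N (B x)]
  have hupp : ∀ x, N' x ≤ (C * ‖B‖ + η) * ‖x‖ := fun x => by
    rw [hN', add_mul]
    refine add_le_add ((hNC _).trans ?_) le_rfl
    rw [mul_assoc]
    exact mul_le_mul_of_nonneg_left (B.le_opNorm x) hC.le
  have hM : ∀ x, N' ((i.comp B) x) ≤ s * N' x := fun x => by
    have h1 : N (B (i (B x))) ≤ b * N (B x) := by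
      rw [h.deriv_apply, map_neg_eq_map]; exact hN2 _
    have h2 : η * ‖i (B x)‖ ≤ (s - b) * N (B x) := by
      have h3 : ‖i (B x)‖ ≤ (‖i‖ + 1) * N (B x) :=
        (i.le_opNorm _).trans (mul_le_mul (by linarith) (hN1 _) (norm_nonneg _) (by positivity))
      calc η * ‖i (B x)‖ ≤ η * ((‖i‖ + 1) * N (B x)) := mul_le_mul_of_nonneg_left h3 hη0.le
        _ = (s - b) * N (B x) := by rw [hη]; field_simp
    have h4 : 0 ≤ s * (η * ‖x‖) := by
      have : 0 ≤ s := ENNReal.toReal_nonneg.trans hs.le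
      positivity
    rw [hN', hN', ContinuousLinearMap.comp_apply]
    linarith
  have hf : HasFDerivAt f (i.comp B) zs :=
    ((i.hasFDerivAt.comp zs h.hasFDerivAt).const_add zs).congr_of_eventuallyEq h.eventually_eq
  have h0 : f zs = zs := by
    rw [h.eventually_eq.self_of_nhds, h.map_fixed, map_zero, add_zero]
  exact ⟨N', ⟨η, hη0, hlow⟩, ⟨C * ‖B‖ + η, by positivity, hupp⟩,
    hf.eventually_seminorm_le h0 hη0 (by positivity) hlow hupp hM hsr⟩

/-- For every `r` below the spectral radius there are, arbitrarily close to `zs`, starting points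
whose errors grow at least like `a ^ k` with `a > r` as long as the iteration stays close
to `zs`. -/
theorem exists_expansion (h : FactorsThrough f zs A i F B) {r : ℝ} (hr0 : 0 ≤ r)
    (hr : r < (spectralRadius ℂ (A.map (algebraMap ℝ ℂ))).toReal) :
    ∃ V ∈ 𝓝 zs, ∃ a, r < a ∧ ∀ U ∈ 𝓝 zs, ∃ z₀ ∈ U, ∃ c, 0 < c ∧
      ((∀ k, f^[k] z₀ ∈ V) → ∀ k : ℕ, c * a ^ k ≤ ‖f^[k] z₀ - zs‖) := by
  obtain ⟨Nu, Ns, a, b, hb0, hba, hra, hu, hs, hn, y, hy⟩ := A.exists_dominated_splitting hr0 hr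
  obtain ⟨Cu, hCu, hNu⟩ := Nu.exists_le_mul_norm_pi
  obtain ⟨Cs, hCs, hNs⟩ := Ns.exists_le_mul_norm_pi
  have ha0 : 0 < a := hb0.trans_lt hba
  -- The admissible relative error per step: the first bound preserves the cone, the second keeps
  -- the growth factor a - τ above r.
  set τ : ℝ := min ((a - b) / 2) ((a - r) / 2) with hτ
  have hτ0 : 0 < τ := lt_min (by linarith) (by linarith)
  have hτ1 : b + τ ≤ a - τ := by have := min_le_left ((a - b) / 2) ((a - r) / 2); linarith
  have hτ2 : r < a - τ := by have := min_le_right ((a - b) / 2) ((a - r) / 2); linarith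
  -- The 2 comes from ‖w‖ ≤ 2 Nu w on the cone Ns ≤ Nu; Cu + Cs serves both seminorms at once.
  set ε : ℝ := τ / (2 * (Cu + Cs) * (‖i‖ + 1)) with hε
  have hε0 : 0 < ε := by positivity
  have hV := (h.hasFDerivAt.isLittleO.bound hε0).and h.eventually_eq
  refine ⟨_, hV, a - τ, hτ2, fun U hU => ?_⟩
  -- Power iteration from `y`: Ns/Nu decays at least like (b/a) ^ j, so some A ^ j y lies in the
  -- cone.
  obtain ⟨y₁, hy₁, hcone⟩ : ∃ y₁, 0 < Nu y₁ ∧ Ns y₁ ≤ Nu y₁ := by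
    have hypos : 0 < Nu y := lt_of_le_of_ne (apply_nonneg Nu y) hy.symm
    have h1 : ∀ j : ℕ, a ^ j * Nu y ≤ Nu ((A ^ j) *ᵥ y) ∧ Ns ((A ^ j) *ᵥ y) ≤ b ^ j * Ns y := by
      intro j
      induction j with
      | zero => simp
      | succ j ih =>
        rw [pow_succ' A, ← mulVec_mulVec, pow_succ', pow_succ', mul_assoc, mul_assoc]
        exact ⟨(mul_le_mul_of_nonneg_left ih.1 ha0.le).trans (hu _),
          (hs _).trans (mul_le_mul_of_nonneg_left ih.2 hb0)⟩
    have hs1 : 0 < Ns y + 1 := by have := apply_nonneg Ns y; linarith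
    obtain ⟨j, hj⟩ := exists_pow_lt_of_lt_one (div_pos hypos hs1) ((div_lt_one ha0).mpr hba)
    have haj : 0 < a ^ j := pow_pos ha0 j
    refine ⟨(A ^ j) *ᵥ y, (by positivity : 0 < a ^ j * Nu y).trans_le (h1 j).1,
      ((h1 j).2.trans ?_).trans (h1 j).1⟩
    rw [div_pow, div_lt_div_iff₀ haj hs1] at hj
    have : b ^ j * Ns y ≤ b ^ j * (Ns y + 1) :=
      mul_le_mul_of_nonneg_left (by linarith) (pow_nonneg hb0 j)
    linarith
  obtain ⟨t, ht, htU⟩ : ∃ t : ℝ, 0 < t ∧ zs + i (t • y₁) ∈ U := by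
    have hc : ContinuousAt (fun t : ℝ => zs + i (t • y₁)) 0 := by fun_prop
    have h1 : ∀ᶠ t : ℝ in 𝓝 0, zs + i (t • y₁) ∈ U := hc (by simpa using hU)
    obtain ⟨t, ht1, ht2⟩ := ((h1.filter_mono nhdsWithin_le_nhds).and
      (self_mem_nhdsWithin (s := Set.Ioi (0 : ℝ)))).exists
    exact ⟨t, ht2, ht1⟩
  have hsmul : ∀ N : Seminorm ℝ (m → ℝ), N (t • y₁) = t * N y₁ := fun N => by
    rw [map_smul_eq_mul, Real.norm_of_nonneg ht.le]
  refine ⟨_, htU, Nu (t • y₁) * (a / (Cu * (‖B‖ + 1))), ?_, fun hstay k => ?_⟩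
  · rw [hsmul]; positivity
  -- One step sends w to -Aw + d, where both seminorms of d are at most τ Nu w. So Nu grows at least
  -- by a - τ, while the new Ns is at most (b + τ) Nu w, which keeps the point in the cone.
  have key : ∀ k : ℕ, ∃ w, f^[k] (zs + i (t • y₁)) = zs + i w ∧ Ns w ≤ Nu w ∧
      Nu (t • y₁) * (a - τ) ^ k ≤ Nu w := by
    intro k
    induction k with
    | zero =>
      refine ⟨t • y₁, rfl, ?_, by simp⟩
      rw [hsmul, hsmul]; exact mul_le_mul_of_nonneg_left hcone ht.le
    | succ k ih =>
      obtain ⟨w, hw1, hw2, hw3⟩ := ih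
      obtain ⟨hV1, hV2⟩ := hstay k
      rw [hw1] at hV1 hV2
      rw [h.map_fixed, sub_zero, add_sub_cancel_left, h.deriv_apply, sub_neg_eq_add] at hV1
      set d := F (zs + i w) + A *ᵥ w with hd
      have hdn : (Cu + Cs) * ‖d‖ ≤ τ * Nu w := by
        have h1 : ‖i w‖ ≤ (‖i‖ + 1) * (2 * Nu w) := by
          refine (i.le_opNorm w).trans
            (mul_le_mul (by linarith) ?_ (norm_nonneg _) (by positivity))
          linarith [hn w]
        calc (Cu + Cs) * ‖d‖ ≤ (Cu + Cs) * (ε * ((‖i‖ + 1) * (2 * Nu w))) :=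
              mul_le_mul_of_nonneg_left
                (hV1.trans (mul_le_mul_of_nonneg_left h1 hε0.le)) (by positivity)
          _ = τ * Nu w := by rw [hε]; field_simp
      have hdu : Nu d ≤ τ * Nu w := by
        refine (hNu d).trans (le_trans ?_ hdn)
        exact mul_le_mul_of_nonneg_right (by linarith) (norm_nonneg d)
      have hds : Ns d ≤ τ * Nu w := by
        refine (hNs d).trans (le_trans ?_ hdn)
        exact mul_le_mul_of_nonneg_right (by linarith) (norm_nonneg d)
      have hFw : F (zs + i w) = d - A *ᵥ w := by rw [hd, add_sub_cancel_right]
      have h1 : (a - τ) * Nu w ≤ Nu (F (zs + i w)) := by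
        have h2 : Nu (A *ᵥ w) ≤ Nu d + Nu (F (zs + i w)) := by
          have h3 : A *ᵥ w = d - F (zs + i w) := by rw [hFw, sub_sub_cancel]
          conv_lhs => rw [h3]
          exact map_sub_le_add Nu _ _
        linarith [hu w]
      have h2 : Ns (F (zs + i w)) ≤ (b + τ) * Nu w := by
        rw [hFw]
        refine (map_sub_le_add Ns _ _).trans ?_
        have := mul_le_mul_of_nonneg_left hw2 hb0
        linarith [hs w]
      refine ⟨F (zs + i w), ?_, ?_, ?_⟩
      · rw [Function.iterate_succ_apply', hw1, hV2]
      · exact (h2.trans (mul_le_mul_of_nonneg_right hτ1 (apply_nonneg Nu w))).trans h1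
      · refine le_trans ?_ h1
        rw [pow_succ', mul_left_comm]
        exact mul_le_mul_of_nonneg_left hw3 (hr0.trans hτ2.le)
  obtain ⟨w, hw1, -, hw3⟩ := key k
  rw [hw1, add_sub_cancel_left]
  -- Growth of w must pass to i w without injectivity of i: B recovers -Aw from i w, and A expands
  -- Nu.
  have h1 : a * Nu w ≤ Cu * (‖B‖ + 1) * ‖i w‖ := by
    refine (hu w).trans ?_
    rw [← map_neg_eq_map Nu, ← h.deriv_apply, mul_assoc]
    refine (hNu _).trans (mul_le_mul_of_nonneg_left ((B.le_opNorm _).trans ?_) hCu.le)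
    exact mul_le_mul_of_nonneg_right (by linarith) (norm_nonneg _)
  have h2 : 0 < Cu * (‖B‖ + 1) := by positivity
  calc Nu (t • y₁) * (a / (Cu * (‖B‖ + 1))) * (a - τ) ^ k
      = a * (Nu (t • y₁) * (a - τ) ^ k) / (Cu * (‖B‖ + 1)) := by ring
    _ ≤ ‖i w‖ := by
      rw [div_le_iff₀ h2, mul_comm ‖i w‖]
      exact (mul_le_mul_of_nonneg_left hw3 ha0.le).trans h1

theorem convergesQLinearly (h : FactorsThrough f zs A i F B)
    (h1 : (spectralRadius ℂ (A.map (algebraMap ℝ ℂ))).toReal < 1) :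
    ConvergesQLinearly f zs (spectralRadius ℂ (A.map (algebraMap ℝ ℂ))).toReal := by
  obtain ⟨s, hs, hs1⟩ := exists_between h1
  obtain ⟨N, hN⟩ := h.exists_contractsNear hs
  refine ⟨hN.locallyConvergent (ENNReal.toReal_nonneg.trans hs.le) hs1, fun r hr hr1 => ?_,
    fun r hr0 hr U hU => ?_⟩
  · obtain ⟨N', hN'⟩ := h.exists_contractsNear hr
    exact hN'.qLinearWithFactor hr1
  · obtain ⟨V, hV, a, hra, hexp⟩ := h.exists_expansion hr0.le hr
    -- Contraction itself keeps the orbits in `V`, so the growth bound holds for all k.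
    obtain ⟨U', hU', hinv⟩ := hN.exists_invariant hs1 hV
    obtain ⟨z₀, hz₀, c, hc, hgrow⟩ := hexp (U ∩ U') (inter_mem hU hU')
    refine ⟨z₀, hz₀.1, fun hO => ?_⟩
    have hgrow' := hgrow fun k => (hinv z₀ hz₀.2 k).1
    have ha0 : 0 < a := hr0.trans hra
    have h2 : (fun k : ℕ => a ^ k) =O[atTop] fun k : ℕ => f^[k] z₀ - zs := by
      refine IsBigO.of_bound c⁻¹ (Eventually.of_forall fun k => ?_)
      rw [Real.norm_of_nonneg (pow_nonneg ha0.le k), inv_mul_eq_div, le_div_iff₀ hc, mul_comm]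
      exact hgrow' k
    exact isLittleO_irrefl (Eventually.of_forall fun k => (pow_pos ha0 k).ne').frequently
      ((h2.trans hO).trans_isLittleO (isLittleO_pow_pow_of_lt_left hr0.le hra))

theorem convergesSuperlinearly (h : FactorsThrough f zs A i F B)
    (h0 : (spectralRadius ℂ (A.map (algebraMap ℝ ℂ))).toReal = 0) :
    ConvergesSuperlinearly f zs :=
  convergesSuperlinearly_of_contractsNear fun _ hr => h.exists_contractsNear (h0.trans_lt hr)

/-- Stability would confine nearby orbits to `V`, where some of them grow at least like c a ^ k with
a > 1. -/
theorem not_isStable (h : FactorsThrough f zs A i F B)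
    (h1 : 1 < (spectralRadius ℂ (A.map (algebraMap ℝ ℂ))).toReal) : ¬ IsStable f zs := by
  intro hst
  obtain ⟨V, hV, a, ha, hexp⟩ := h.exists_expansion zero_le_one h1
  obtain ⟨ε, hε, hball⟩ := Metric.mem_nhds_iff.mp hV
  obtain ⟨δ, hδ, hstay⟩ := hst ε hε
  obtain ⟨z₀, hz₀, c, hc, hgrow⟩ := hexp _ (Metric.ball_mem_nhds zs hδ)
  obtain ⟨k, hk⟩ := pow_unbounded_of_one_lt (ε / c) ha
  have h2 := hgrow (fun k => hball (hstay z₀ hz₀ k)) k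
  have h3 := hstay z₀ hz₀ k
  rw [dist_eq_norm] at h3
  rw [div_lt_iff₀ hc] at hk
  linarith

end FactorsThrough

end Dynamics

/-! ### The solution operator, and examples with spectral radius one -/

namespace SQPMethod

variable {nv ng nh : ℕ} {P : SQPMethod nv ng nh} {zs : PrimalDual nv ng nh}
  {π : PrimalDual nv ng nh → PrimalDual nv ng nh}

/-- Close to a regular fixed point the solution operator gives the unique KKT point. -/
theorem IsSolutionOperator.eventually_isKKT_iff (hπ : P.IsSolutionOperator π)
    (h : P.IsRegularAt zs) (hf : P.RegularFixedPoint zs) :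
    ∀ᶠ z in 𝓝 zs, π z = zs + P.extend zs (P.redStep zs z) ∧
      ∀ w, (P.localQP z).IsKKT w ↔ w = π z := by
  filter_upwards [SQPMethod.eventually_isKKT_iff h hf] with z hz
  have h1 : π z = zs + P.extend zs (P.redStep zs z) := (hz _).mp (hπ z ⟨_, (hz _).mpr rfl⟩)
  exact ⟨h1, fun w => by rw [h1]; exact hz w⟩

theorem IsSolutionOperator.factorsThrough (hπ : P.IsSolutionOperator π)
    (h : P.IsRegularAt zs) (hf : P.RegularFixedPoint zs) :
    FactorsThrough π zs (P.iterationMatrix zs) (P.extendCLM zs) (P.redStep zs)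
      (P.redStepDeriv zs) where
  eventually_eq := (hπ.eventually_isKKT_iff h hf).mono fun _ hz => hz.1
  map_fixed := redStep_self hf.fixed
  hasFDerivAt := hasFDerivAt_redStep h hf
  deriv_apply := redStepDeriv_extend h hf.fixed

/-! ### Gradient descent in one variable -/

/-- Gradient descent with unit step length for the unconstrained minimization of `f`, as an
SQP-type method with Hessian approximation `1`. -/
def gradientDescent (f : ℝ → ℝ) : SQPMethod 1 0 0 where
  f v := f (v 0)
  g _ := 0
  h _ := 0
  W _ := 1
  q z _ := deriv f (z.1 0)
  G _ := 0
  H _ := 0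

/-- The solution operator of `gradientDescent f`. -/
def gradientStep (f : ℝ → ℝ) (z : PrimalDual 1 0 0) : PrimalDual 1 0 0 :=
  (fun _ => z.1 0 - deriv f (z.1 0), 0)

section GradientDescent

variable {f : ℝ → ℝ}

theorem isKKT_gradientDescent_iff (z w : PrimalDual 1 0 0) :
    ((gradientDescent f).localQP z).IsKKT w ↔ w = gradientStep f z := by
  have h1 : ((gradientDescent f).localQP z).IsKKT w ↔ w.1 0 - z.1 0 + deriv f (z.1 0) = 0 := by
    constructor
    · intro h
      simpa [gradientDescent, localQP] using congrFun h.stationary 0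
    · intro h
      refine ⟨funext fun i => ?_, Subsingleton.elim _ _, fun i => i.elim0, fun i => i.elim0,
        fun i => i.elim0⟩
      rw [Subsingleton.elim i 0]
      simpa [gradientDescent, localQP] using h
  rw [h1]
  constructor
  · intro h
    refine Prod.ext (funext fun i => ?_) (Subsingleton.elim _ _)
    rw [Subsingleton.elim i 0]
    simp only [gradientStep]
    linarith
  · rintro rfl
    simp only [gradientStep]
    ring

theorem isSolutionOperator_gradientStep : (gradientDescent f).IsSolutionOperator (gradientStep f) :=
  fun z _ => (isKKT_gradientDescent_iff z _).mpr rfl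

theorem hasFDerivAt_gradientDescent_q (hf' : HasDerivAt (deriv f) 0 0) :
    HasFDerivAt (gradientDescent f).q (0 : PrimalDual 1 0 0 →L[ℝ] (Fin 1 → ℝ)) 0 := by
  refine hasFDerivAt_pi'.mpr fun i => ?_
  have h2 : HasFDerivAt (fun z : PrimalDual 1 0 0 => z.1 0)
      ((ContinuousLinearMap.proj (R := ℝ) (φ := fun _ : Fin 1 => ℝ) 0).comp
        (ContinuousLinearMap.fst ℝ _ _)) 0 :=
    hasFDerivAt_pi'.mp hasFDerivAt_fst 0
  convert! HasDerivAt.comp_hasFDerivAt (h₂ := deriv f) (0 : PrimalDual 1 0 0) hf' h2 using 1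
  simp

theorem isRegularAt_gradientDescent (hf : ContDiff ℝ 2 f) (hf' : HasDerivAt (deriv f) 0 0) :
    (gradientDescent f).IsRegularAt 0 where
  contDiff_f := hf.comp (contDiff_apply ℝ ℝ 0)
  contDiff_g := contDiff_const
  contDiff_h := contDiff_const
  posSemidef_W _ := Matrix.PosSemidef.one
  continuousAt_W _ _ := continuousAt_const
  differentiableAt_q := (hasFDerivAt_gradientDescent_q hf').differentiableAt
  differentiableAt_G _ _ := differentiableAt_const _
  differentiableAt_H _ _ := differentiableAt_const _

theorem regularFixedPoint_gradientDescent (h0 : deriv f 0 = 0) :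
    (gradientDescent f).RegularFixedPoint 0 := by
  have hfix : (gradientDescent f).IsFixedPoint 0 := by
    refine (isKKT_gradientDescent_iff 0 0).mpr (Prod.ext (funext fun i => ?_) rfl)
    simp [gradientStep, h0]
  refine ⟨hfix, ⟨hfix, fun d _ hd => ?_⟩, ?_, fun i => i.elim0⟩
  · have h1 : d ⬝ᵥ (((gradientDescent f).localQP 0).W *ᵥ d) = d ⬝ᵥ d := by
      simp [gradientDescent, localQP]
    rw [h1]
    exact lt_of_le_of_ne (Finset.sum_nonneg fun i _ => mul_self_nonneg _)
      (Ne.symm (mt dotProduct_self_eq_zero.mp hd))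
  · have : IsEmpty (Fin 0 ⊕ ((gradientDescent f).localQP 0).active 0) :=
      ⟨fun i => i.elim Fin.elim0 fun i => i.1.elim0⟩
    exact linearIndependent_empty_type

/-- There are no multipliers, and ∂q/∂v = f''(0) = 0, so K = 1, L = E = -W = -1 and A = -1. -/
theorem kappa_gradientDescent (hf' : HasDerivAt (deriv f) 0 0) :
    (gradientDescent f).kappa 0 = 1 := by
  have hK : (gradientDescent f).K 0 = 1 := by
    ext i j
    rcases i with i | i | i
    · rcases j with j | j | j
      · rw [K, fromBlocks_apply₁₁]
        simp [gradientDescent, Matrix.one_apply]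
      · exact j.elim0
      · exact j.1.elim0
    · exact i.elim0
    · exact i.1.elim0
  have hq : fderiv ℝ (fun v => (gradientDescent f).q (v, (0 : PrimalDual 1 0 0).2)) 0 = 0 := by
    have h1 := HasFDerivAt.comp (g := (gradientDescent f).q) (0 : Fin 1 → ℝ)
      (hasFDerivAt_gradientDescent_q hf')
      (hasFDerivAt_prodMk_left (𝕜 := ℝ) (0 : Fin 1 → ℝ) (0 : PrimalDual 1 0 0).2)
    rw [ContinuousLinearMap.zero_comp] at h1
    exact h1.fderiv
  have hG : (fun v => (gradientDescent f).GRed 0 v *ᵥ (gradientDescent f).redMul 0)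
      = fun _ => 0 := by
    funext v i
    simp only [mulVec, dotProduct]
    refine Finset.sum_eq_zero fun j _ => ?_
    rcases j with j | j
    · exact j.elim0
    · exact j.1.elim0
  have hL : (gradientDescent f).L 0 = -1 := by
    ext i j
    rcases i with i | i | i
    · rcases j with j | j | j
      · have hE : (gradientDescent f).E 0 = -1 := by
          rw [E, hG, jacobianMatrix, jacobianMatrix]
          change LinearMap.toMatrix' (fderiv ℝ (fun v => (gradientDescent f).q
            (v, (0 : PrimalDual 1 0 0).2)) 0).toLinearMap + _ - _ = _
          rw [hq]
          simp [gradientDescent]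
        simp [L, hE, Matrix.one_apply]
      · exact j.elim0
      · exact j.1.elim0
    · exact i.elim0
    · exact i.1.elim0
  have hA : ((gradientDescent f).iterationMatrix 0).map (algebraMap ℝ ℂ)
      = algebraMap ℂ _ (-1 : ℂ) := by
    rw [iterationMatrix, hK, hL, inv_one, one_mul, map_neg, map_one, Matrix.map_neg _ (by simp),
      Matrix.map_one _ (by simp) (by simp)]
  have : Nonempty ((gradientDescent f).RedIdx 0) := ⟨Sum.inl 0⟩
  rw [kappa, hA, spectralRadius, spectrum.scalar_eq]
  simp

theorem gradientStep_iterate (z : PrimalDual 1 0 0) (k : ℕ) :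
    ((gradientStep f)^[k] z).1 0 = (fun x => x - deriv f x)^[k] (z.1 0) := by
  induction k with
  | zero => rfl
  | succ k ih => rw [Function.iterate_succ_apply', Function.iterate_succ_apply', ← ih]; rfl

end GradientDescent

/-- The moduli decrease, and their limit l satisfies l = l - l³, hence l = 0. -/
theorem tendsto_iterate_sub_cube {x : ℝ} (hx : |x| < 1) :
    Tendsto (fun k => (fun x : ℝ => x - x ^ 3)^[k] x) atTop (𝓝 0) := by
  set u : ℕ → ℝ := fun k => (fun x : ℝ => x - x ^ 3)^[k] x with hu
  have hsucc : ∀ k, u (k + 1) = u k - u k ^ 3 := fun k => Function.iterate_succ_apply' _ _ _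
  have habs : ∀ y : ℝ, |y| < 1 → |y - y ^ 3| = |y| - |y| ^ 3 := fun y hy => by
    have h1 : y - y ^ 3 = y * (1 - |y| ^ 2) := by rw [sq_abs]; ring
    have h2 : 0 ≤ 1 - |y| ^ 2 := by
      have := pow_le_one₀ (n := 2) (abs_nonneg y) hy.le
      linarith
    rw [h1, abs_mul, abs_of_nonneg h2]
    ring
  have hlt : ∀ k, |u k| < 1 := by
    intro k
    induction k with
    | zero => exact hx
    | succ k ih =>
      rw [hsucc, habs _ ih]
      have := pow_nonneg (abs_nonneg (u k)) 3
      linarith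
  have hrec : ∀ k, |u (k + 1)| = |u k| - |u k| ^ 3 := fun k => by rw [hsucc, habs _ (hlt k)]
  have hanti : Antitone fun k => |u k| := antitone_nat_of_succ_le fun k => by
    rw [hrec]; linarith [pow_nonneg (abs_nonneg (u k)) 3]
  have hlim := tendsto_atTop_ciInf hanti ⟨0, by rintro _ ⟨k, rfl⟩; exact abs_nonneg _⟩
  set l := ⨅ k, |u k| with hl
  have h1 : Tendsto (fun k => |u (k + 1)|) atTop (𝓝 (l - l ^ 3)) := by
    simp only [hrec]
    exact hlim.sub (hlim.pow 3)
  have h2 := tendsto_nhds_unique h1 (hlim.comp (tendsto_add_atTop_nat 1))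
  have h3 : l = 0 := pow_eq_zero_iff (n := 3) (by norm_num) |>.mp (by linarith)
  rw [h3] at hlim
  exact tendsto_zero_iff_abs_tendsto_zero _ |>.mpr hlim

theorem deriv_pow_four_div_four : deriv (fun x : ℝ => x ^ 4 / 4) = fun x => x ^ 3 := by
  funext x
  rw [((hasDerivAt_pow 4 x).div_const 4).deriv]
  push_cast
  ring

/-- Gradient descent for `x ^ 4 / 4` converges locally. -/
theorem locallyConvergent_gradientStep_pow_four :
    LocallyConvergent (gradientStep fun x => x ^ 4 / 4) 0 := by
  refine ⟨Metric.ball 0 1, Metric.ball_mem_nhds _ one_pos, fun z₀ hz₀ => ?_⟩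
  have hx : |z₀.1 0| < 1 := by
    rw [mem_ball_zero_iff] at hz₀
    exact ((norm_le_pi_norm z₀.1 0).trans (norm_fst_le z₀)).trans_lt hz₀
  have h1 : Tendsto (fun k => ((gradientStep fun x => x ^ 4 / 4)^[k] z₀).1) atTop (𝓝 0) := by
    refine tendsto_pi_nhds.mpr fun i => ?_
    rw [Subsingleton.elim i 0]
    simp only [gradientStep_iterate, deriv_pow_four_div_four]
    exact tendsto_iterate_sub_cube hx
  have h2 : Tendsto (fun k => ((gradientStep fun x => x ^ 4 / 4)^[k] z₀).2) atTop (𝓝 0) :=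
    tendsto_const_nhds.congr fun _ => Subsingleton.elim _ _
  exact h1.prodMk_nhds h2

/-- Gradient descent for a constant function does not move. -/
theorem not_locallyConvergent_gradientStep_zero :
    ¬ LocallyConvergent (gradientStep fun _ => 0) 0 := by
  rintro ⟨U, hU, hconv⟩
  obtain ⟨ε, hε, hball⟩ := Metric.mem_nhds_iff.mp hU
  set z₀ : PrimalDual 1 0 0 := (fun _ => ε / 2, 0) with hz₀
  have hmem : z₀ ∈ Metric.ball (0 : PrimalDual 1 0 0) ε := by
    rw [mem_ball_zero_iff, hz₀, Prod.norm_mk, norm_zero, pi_norm_const, Real.norm_of_nonneg]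
    · exact max_lt (by linarith) hε
    · positivity
  have h1 := hconv z₀ (hball hmem)
  have hfix : ∀ k, (gradientStep fun _ => 0)^[k] z₀ = z₀ := fun k =>
    Function.iterate_fixed (by simp [gradientStep, hz₀]) k
  simp only [hfix] at h1
  have h2 := tendsto_nhds_unique h1 tendsto_const_nhds
  have h3 : ε / 2 = 0 := congrFun (congrArg Prod.fst h2).symm 0
  linarith

end SQPMethod

theorem mainTheorem1 :
    (∀ (nv ng nh : ℕ) (P : SQPMethod nv ng nh)
        (π : PrimalDual nv ng nh → PrimalDual nv ng nh) (zs : PrimalDual nv ng nh),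
      P.IsRegularAt zs → P.IsSolutionOperator π → P.RegularFixedPoint zs →
        -- close to `zs` the iteration map is well defined, and `zs` is a fixed point of it
        (∀ᶠ z in 𝓝 zs, ∀ w, (P.localQP z).IsKKT w ↔ w = π z) ∧
        π zs = zs ∧
        -- `K⋆` and `L⋆` are the partial Jacobians of the reduced residual; `K⋆` is invertible
        HasFDerivAt (fun x => P.residual zs x (P.redPoint zs))
          (LinearMap.toContinuousLinearMap (Matrix.toLin' (P.K zs))) (P.redPoint zs) ∧
        HasFDerivAt (fun y => P.residual zs (P.redPoint zs) y)
          (LinearMap.toContinuousLinearMap (Matrix.toLin' (P.L zs))) (P.redPoint zs) ∧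
        IsUnit (P.K zs) ∧
        -- the spectral radius determines the local behaviour
        (0 < P.kappa zs → P.kappa zs < 1 → ConvergesQLinearly π zs (P.kappa zs)) ∧
        (P.kappa zs = 0 → ConvergesSuperlinearly π zs) ∧
        (1 < P.kappa zs → ¬ IsStable π zs)) ∧
    -- if the spectral radius is one, local convergence may or may not take place
    (∃ (nv ng nh : ℕ) (P : SQPMethod nv ng nh)
        (π : PrimalDual nv ng nh → PrimalDual nv ng nh) (zs : PrimalDual nv ng nh),
      P.IsRegularAt zs ∧ P.IsSolutionOperator π ∧ P.RegularFixedPoint zs ∧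
        P.kappa zs = 1 ∧ LocallyConvergent π zs) ∧
    (∃ (nv ng nh : ℕ) (P : SQPMethod nv ng nh)
        (π : PrimalDual nv ng nh → PrimalDual nv ng nh) (zs : PrimalDual nv ng nh),
      P.IsRegularAt zs ∧ P.IsSolutionOperator π ∧ P.RegularFixedPoint zs ∧
        P.kappa zs = 1 ∧ ¬ LocallyConvergent π zs) := by
  refine ⟨fun nv ng nh P π zs h hπ hf => ?_, ?_, ?_⟩
  · have hev := hπ.eventually_isKKT_iff h hf
    have hfac := hπ.factorsThrough h hf
    exact ⟨hev.mono fun _ hz => hz.2, ((hev.self_of_nhds.2 zs).mp hf.fixed).symm,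
      hf.fixed.hasFDerivAt_residual_left, h.hasFDerivAt_residual_right hf.fixed,
      SQPMethod.isUnit_K hf, fun _ h1 => hfac.convergesQLinearly h1,
      hfac.convergesSuperlinearly, hfac.not_isStable⟩
  · have hd' : HasDerivAt (deriv fun x : ℝ => x ^ 4 / 4) 0 0 := by
      rw [SQPMethod.deriv_pow_four_div_four]
      simpa using hasDerivAt_pow 3 (0 : ℝ)
    exact ⟨1, 0, 0, SQPMethod.gradientDescent fun x => x ^ 4 / 4, _, 0,
      SQPMethod.isRegularAt_gradientDescent (by fun_prop) hd',
      SQPMethod.isSolutionOperator_gradientStep,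
      SQPMethod.regularFixedPoint_gradientDescent (by simp),
      SQPMethod.kappa_gradientDescent hd', SQPMethod.locallyConvergent_gradientStep_pow_four⟩
  · have hd' : HasDerivAt (deriv fun _ : ℝ => (0 : ℝ)) 0 0 := by
      simpa using hasDerivAt_const (0 : ℝ) (0 : ℝ)
    exact ⟨1, 0, 0, SQPMethod.gradientDescent fun _ => 0, _, 0,
      SQPMethod.isRegularAt_gradientDescent contDiff_const hd',
      SQPMethod.isSolutionOperator_gradientStep,
      SQPMethod.regularFixedPoint_gradientDescent (by simp),
      SQPMethod.kappa_gradientDescent hd', SQPMethod.not_locallyConvergent_gradientStep_zero⟩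

end
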